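/- Let $k,n,m\in\mathbb{N}$ (zero allowed), let $\mathcal X_{n,m}=\{x_{ij}: i\in[n],\,j\in[m]\}$, and let $p\in\mathbb{Q}[\mathcal X_{n,m}]$ be a polynomial. For a finite bipartite multigraph $F$ with fixed bipartition $A\uplus B$ (possibly without vertices), let $$\hom_{F,n,m}=\sum_{h}\ \prod_{ab\in E(F)}x_{h(a)h(b)}\in\mathbb{Q}[\mathcal X_{n,m}],$$ where $h$ ranges over all maps $A\uplus B\to[n]\uplus[m]$ with $h(A)\subseteq[n]$ and $h(B)\subseteq[m]$, and edges are taken with multiplicity. Let $\mathfrak{T}^k_{n,m}$ be the set of finite $\mathbb{Q}$-linear combinations of polynomials $\hom_{F,n,m}$ with $F$ of treewidth less than $k$ (the treewidth is the least, over all tree decompositions, of the maximal bag size minus one; so it is $-1$ for the graph without vertices). The multilinearisation of a polynomial is obtained by replacing every non-zero exponent by $1$; two polynomials are equal up to multilinearisation if their multilinearisations coincide. An $(n,m)$-vertex simple bipartite graph is a matrix $G\in\{0,1\}^{n\times m}$. View it as a relational structure with universe $[n]\uplus[m]$, unary relations $A=[n]$ and $B=[m]$, and binary relations $R_q=\{(i,j)\in[n]\times[m]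 : G(i,j)=q\}$ for $q\in\mathbb{Q}$. Two such graphs are $\mathcal{C}^k$-equivalent if they satisfy the same sentences of first-order logic with equality and counting quantifiers $\exists^{\ge i}x$ $(i\in\mathbb{N})$ that use at most $k$ distinct variables. The counting width of $p$ on $(n,m)$-vertex simple bipartite graphs is the least $k'\in\mathbb{N}$ such that $p(G)=p(H)$ for all $\mathcal{C}^{k'}$-equivalent $G,H\in\{0,1\}^{n\times m}$, and it is $\infty$ if there is no such $k'$ (that is, if $p$ is not invariant under row and column permutations on $\{0,1\}^{n\times m}$). Then the following are equivalent: 1. there exists $q\in\mathfrak{T}^k_{n,m}$ such that $p$ and $q$ are equal up to multilinearisation; 2. the counting width of $p$ on $(n,m)$-vertex simple bipartite graphs is at most $k$. -/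

import Mathlib

/-- A finite bipartite multigraph with fixed bipartition `A ⊎ B`. An edge `(a, b)` joins `a : A`
with `b : B`; its multiplicity in `E` is the number of parallel edges. -/
structure BipMultigraph where
  A : Type
  B : Type
  [fintypeA : Fintype A]
  [fintypeB : Fintype B]
  [decEqA : DecidableEq A]
  [decEqB : DecidableEq B]
  E : Multiset (A × B)

attribute [instance] BipMultigraph.fintypeA BipMultigraph.fintypeB
  BipMultigraph.decEqA BipMultigraph.decEqB

namespace BipMultigraph

/-- The vertex set of a bipartite multigraph. -/
abbrev V (F : BipMultigraph) : Type := F.A ⊕ F.B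

/-- A tree decomposition of `F`: a finite tree together with a bag of vertices of `F` at each of
its nodes. -/
structure TreeDecomposition (F : BipMultigraph) where
  Node : Type
  [fintypeNode : Fintype Node]
  tree : SimpleGraph Node
  isTree : tree.IsTree
  bag : Node → Finset F.V
  vertex_covered : ∀ v : F.V, ∃ t, v ∈ bag t
  edge_covered : ∀ e ∈ F.E, ∃ t, (Sum.inl e.1 : F.V) ∈ bag t ∧ (Sum.inr e.2 : F.V) ∈ bag t
  connected : ∀ v : F.V, (tree.induce {t | v ∈ bag t}).Connected

attribute [instance] TreeDecomposition.fintypeNode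

/-- The width of a tree decomposition: the maximal size of a bag, minus one. -/
def TreeDecomposition.width {F : BipMultigraph} (D : F.TreeDecomposition) : ℤ :=
  ((Finset.univ.sup fun t => (D.bag t).card : ℕ) : ℤ) - 1

/-- The treewidth of `F`: the minimal width of a tree decomposition of `F`. It is an integer; the
graph without vertices has treewidth `-1`. -/
noncomputable def treewidth (F : BipMultigraph) : ℤ :=
  sInf (Set.range fun D : F.TreeDecomposition => D.width)

/-- The homomorphism polynomial of `F` in the variables `x_{ij}`, `i ∈ [n]`, `j ∈ [m]`. -/
noncomputable def homPoly (F : BipMultigraph) (n m : ℕ) : MvPolynomial (Fin n × Fin m) ℚ :=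
  ∑ f : F.A → Fin n, ∑ g : F.B → Fin m,
    (F.E.map fun e => (MvPolynomial.X (f e.1, g e.2) : MvPolynomial (Fin n × Fin m) ℚ)).prod

end BipMultigraph

/-- The finite `ℚ`-linear combinations of homomorphism polynomials of bipartite multigraphs of
treewidth less than `k`. -/
noncomputable def treewidthSpan (k n m : ℕ) : Submodule ℚ (MvPolynomial (Fin n × Fin m) ℚ) :=
  Submodule.span ℚ {q | ∃ F : BipMultigraph, F.treewidth < (k : ℤ) ∧ q = F.homPoly n m}

/-- The multilinearisation of a polynomial: every non-zero exponent is replaced by `1`. -/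
noncomputable def multilinearisation {σ : Type} (p : MvPolynomial σ ℚ) : MvPolynomial σ ℚ :=
  ∑ s ∈ p.support, MvPolynomial.monomial (s.mapRange (fun e => min e 1) rfl) (p.coeff s)

/-- Edge-weighted `(n,m)`-vertex bipartite graphs, given by their bi-adjacency matrices. -/
abbrev WeightedBip (n m : ℕ) : Type := Matrix (Fin n) (Fin m) ℚ

/-- Simple `(n,m)`-vertex bipartite graphs are the elements of `{0,1}^{n × m}`. -/
def WeightedBip.IsSimple {n m : ℕ} (G : WeightedBip n m) : Prop :=
  ∀ i j, G i j = 0 ∨ G i j = 1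

/-- Formulas of first-order logic with counting quantifiers which use only the `k` variables
`Fin k`, over the signature with equality, two unary symbols `A`, `B` and a binary
symbol `R_q` for every `q ∈ ℚ`. Here `existsGe i x φ` is the formula `∃^{≥ i} x φ`. -/
inductive CFormula (k : ℕ) : Type
  | falsum : CFormula k
  | eq (x y : Fin k) : CFormula k
  | inA (x : Fin k) : CFormula k
  | inB (x : Fin k) : CFormula k
  | rel (q : ℚ) (x y : Fin k) : CFormula k
  | neg (φ : CFormula k) : CFormula k
  | and (φ ψ : CFormula k) : CFormula k
  | existsGe (i : ℕ) (x : Fin k) (φ : CFormula k) : CFormula k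

namespace CFormula

/-- The free variables of a formula. -/
def freeVars {k : ℕ} : CFormula k → Finset (Fin k)
  | falsum => ∅
  | eq x y => {x, y}
  | inA x => {x}
  | inB x => {x}
  | rel _ x y => {x, y}
  | neg φ => φ.freeVars
  | and φ ψ => φ.freeVars ∪ ψ.freeVars
  | existsGe _ x φ => φ.freeVars.erase x

/-- A sentence is a formula without free variables. -/
def IsSentence {k : ℕ} (φ : CFormula k) : Prop := φ.freeVars = ∅

/-- Satisfaction in the structure with universe `[n] ⊎ [m]` given by `G`, under a partial
assignment of the variables that is meant to be defined on the free variables. -/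
def Realize {k n m : ℕ} (G : WeightedBip n m) :
    CFormula k → (Fin k → Option (Fin n ⊕ Fin m)) → Prop
  | falsum, _ => False
  | eq x y, v => ∃ a, v x = some a ∧ v y = some a
  | inA x, v => ∃ i : Fin n, v x = some (Sum.inl i)
  | inB x, v => ∃ j : Fin m, v x = some (Sum.inr j)
  | rel q x y, v => ∃ (i : Fin n) (j : Fin m),
      v x = some (Sum.inl i) ∧ v y = some (Sum.inr j) ∧ G i j = q
  | neg φ, v => ¬ φ.Realize G v
  | and φ ψ, v => φ.Realize G v ∧ ψ.Realize G v
  | existsGe i x φ, v =>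
      i ≤ {a : Fin n ⊕ Fin m | φ.Realize G (Function.update v x (some a))}.ncard

/-- Satisfaction of sentences: no variable needs to be assigned. -/
def Models {k n m : ℕ} (G : WeightedBip n m) (φ : CFormula k) : Prop :=
  φ.Realize G fun _ => none

end CFormula

/-- `G` and `H` are `C^k`-equivalent if they satisfy the same sentences of the `k`-variable
fragment of first-order logic with counting quantifiers. -/
def CEquiv (k : ℕ) {n m : ℕ} (G H : WeightedBip n m) : Prop :=
  ∀ φ : CFormula k, φ.IsSentence → (φ.Models G ↔ φ.Models H)

/-- The counting width of `f` on `(n,m)`-vertex simple bipartite graphs: the least `k` such that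
`f` agrees on any two `C^k`-equivalent simple graphs. It is `⊤` if there is no such `k`, which
happens exactly for those `f` that are not invariant under row and column permutations of simple
graphs. -/
noncomputable def simpleCountingWidth {n m : ℕ} (f : WeightedBip n m → ℚ) : ℕ∞ :=
  sInf ((fun k : ℕ => (k : ℕ∞)) '' {k : ℕ | ∀ G H : WeightedBip n m,
    G.IsSimple → H.IsSimple → CEquiv k G H → f G = f H})

/-- The value `p(G)` of the polynomial `p` at the bi-adjacency matrix of `G`. -/
noncomputable def evalAt {n m : ℕ} (p : MvPolynomial (Fin n × Fin m) ℚ) (G : WeightedBip n m) : ℚ :=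
  MvPolynomial.eval (fun ij : Fin n × Fin m => G ij.1 ij.2) p

/-!
The proof goes through functions of placements. For a set `L` of labels, a placement is a
map `σ : L → [n] ⊎ [m]`, and a bipartite multigraph some of whose vertices carry labels gives a
function of `σ` with values in polynomials: the sum over all positions of the unlabelled vertices.
The labelled graphs with a tree decomposition into bags of size at most `k`, one of which contains
all labels, are generated by single atoms, products (gluing along the labels) and summation over the
position of a label (forgetting it). This is the inductive predicate `Gen`. Vertices are not assigned
to a side beforehand: an atom whose vertices lie on the wrong sides evaluates to zero, and there are
atoms that only prescribe a side. Both implications are inductions over `Gen` or over formulas.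

*Homomorphism polynomials are invariant.* Eliminating the vertices of a graph of treewidth less than
`k` along a tree decomposition, leaf by leaf, shows that its homomorphism polynomial is a multiple of
a polynomial generated without labels (`BipMultigraph.exists_gen_of_treewidth_lt`). By induction, the
value of a generated function depends only on the `k`-variable type of the labelled vertices
(`Gen.eval_eq`). In the summation step the bags have size at most `k`, so a variable is free, and
counting quantifiers provide a type-preserving bijection between the possible positions
(`CFormula.Indist.exists_equiv`).

*Sentences are combinations of homomorphism polynomials.* By induction on a formula, its truth value
on simple graphs is a combination of generated functions of the positions of its variables, as long
as different labels have different positions (`CFormula.exists_represent`). For a counting quantifier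
the witnesses are counted, those at the position of another label separately, and the threshold
is a univariate polynomial in this number. For a sentence there are no labels left, and a polynomial
generated without labels is the value of a graph with a tree decomposition into bags of size at most
`k`, whose vertices are then distributed to the two sides in all possible ways
(`Gen.exists_mem_treewidthSpan`).

Finally, there are finitely many simple graphs, so each `C^k`-equivalence class of them is defined by
one sentence and every invariant function is a combination of indicators of classes; and polynomials
agree on simple graphs if and only if they are equal up to multilinearisation, since a multilinear
polynomial that vanishes on the cube is zero.
-/

/-! ### Functions of placements given by labelled graphs -/

/-- The possible factors of a labelled homomorphism polynomial: an edge, or the requirement that a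
vertex lies on a given side. Vertices carry no side of their own. -/
inductive Atom (V : Type) : Type
  | edge (a b : V) : Atom V
  | inA (a : V) : Atom V
  | inB (a : V) : Atom V

namespace Atom

variable {V W : Type} {n m : ℕ}

/-- The vertices occurring in an atom. -/
def verts : Atom V → Set V
  | edge a b => {a, b}
  | inA a => {a}
  | inB a => {a}

/-- Renaming the vertices of an atom. -/
def map (e : V → W) : Atom V → Atom W
  | edge a b => edge (e a) (e b)
  | inA a => inA (e a)
  | inB a => inB (e a)

/-- The value of an atom under a placement `σ` of the vertices. It vanishes when a vertex is
placed on the wrong side, so that sums over all placements are sums over the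
side-preserving ones. -/
noncomputable def eval (σ : V → Fin n ⊕ Fin m) : Atom V → MvPolynomial (Fin n × Fin m) ℚ
  | edge a b => match σ a, σ b with
    | .inl i, .inr j => MvPolynomial.X (i, j)
    | _, _ => 0
  | inA a => match σ a with
    | .inl _ => 1
    | .inr _ => 0
  | inB a => match σ a with
    | .inl _ => 0
    | .inr _ => 1

lemma eval_map (e : V → W) (σ : W → Fin n ⊕ Fin m) (α : Atom V) :
    (α.map e).eval σ = α.eval (σ ∘ e) := by
  cases α <;> rfl

lemma verts_map (e : V → W) (α : Atom V) : (α.map e).verts = e '' α.verts := by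
  cases α <;> simp [map, verts, Set.image_pair]

lemma eval_congr {σ τ : V → Fin n ⊕ Fin m} {α : Atom V} (h : ∀ v ∈ α.verts, σ v = τ v) :
    α.eval σ = α.eval τ := by
  cases α <;> simp only [verts, Set.mem_insert_iff, Set.mem_singleton_iff, forall_eq_or_imp,
    forall_eq] at h <;> simp [eval, h]

end Atom

/-- The functions of placements `σ : L → [n] ⊎ [m]` given by labelled bipartite multigraphs that
have a tree decomposition into bags of size at most `k` with a bag containing the set `S` of
labelled vertices. They are generated by single atoms, products and summation over the position of
a labelled vertex. -/
inductive Gen {n m : ℕ} {L : Type} [DecidableEq L] (k : ℕ) :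
    Finset L → ((L → Fin n ⊕ Fin m) → MvPolynomial (Fin n × Fin m) ℚ) → Prop
  | one {S : Finset L} (hS : S.card ≤ k) : Gen k S 1
  | atom {S : Finset L} (hS : S.card ≤ k) (α : Atom L) (hα : α.verts ⊆ S) :
      Gen k S fun σ => α.eval σ
  | mul {S T : Finset L} {f g : (L → Fin n ⊕ Fin m) → MvPolynomial (Fin n × Fin m) ℚ}
      (hST : S ⊆ T) (hf : Gen k S f) (hg : Gen k T g) : Gen k T (f * g)
  | sum {S : Finset L} {a : L} {f : (L → Fin n ⊕ Fin m) → MvPolynomial (Fin n × Fin m) ℚ}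
      (ha : a ∉ S) (hf : Gen k (insert a S) f) :
      Gen k S fun σ => ∑ u, f (Function.update σ a u)

namespace Gen

variable {n m k : ℕ} {L : Type} [DecidableEq L] {S T : Finset L}
  {f g : (L → Fin n ⊕ Fin m) → MvPolynomial (Fin n × Fin m) ℚ}

lemma card_le (hf : Gen k S f) : S.card ≤ k := by
  induction hf with
  | one hS => exact hS
  | atom hS => exact hS
  | mul _ _ _ _ h => exact h
  | sum _ _ h => exact (Finset.card_le_card (Finset.subset_insert _ _)).trans h

lemma weaken (hf : Gen k S f) (hST : S ⊆ T) (hT : T.card ≤ k) : Gen k T f := by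
  simpa using Gen.mul hST hf (.one hT)

lemma congr (hf : Gen k S f) {σ τ : L → Fin n ⊕ Fin m} (h : ∀ s ∈ S, σ s = τ s) :
    f σ = f τ := by
  induction hf generalizing σ τ with
  | one => rfl
  | atom _ α hα => exact Atom.eval_congr fun v hv => h v (by simpa using hα hv)
  | mul hST _ _ ihf ihg => simp [ihf fun s hs => h s (hST hs), ihg h]
  | sum ha _ ih =>
    refine Finset.sum_congr rfl fun u _ => ih fun s hs => ?_
    rcases Finset.mem_insert.1 hs with rfl | hs
    · simp
    · have h1 : s ≠ _ := ne_of_mem_of_not_mem hs ha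
      simp [h1, h s hs]

/-- Renaming and identifying labelled vertices. -/
lemma pull {L' : Type} [DecidableEq L'] [Infinite L'] (hf : Gen k S f) (π : L → L') :
    Gen k (S.image π) fun σ => f (σ ∘ π) := by
  induction hf generalizing π with
  | one hS => exact .one (Finset.card_image_le.trans hS)
  | atom hS α hα =>
    simp only [← Atom.eval_map]
    refine .atom (Finset.card_image_le.trans hS) _ ?_
    rw [Atom.verts_map, Finset.coe_image]
    exact Set.image_mono hα
  | mul hST _ _ ihf ihg => exact .mul (Finset.image_subset_image hST) (ihf π) (ihg π)
  | @sum S a f ha hf ih =>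
    -- the summed vertex gets a fresh name, so that it is not captured by `π`
    obtain ⟨a', ha'⟩ := Infinite.exists_notMem_finset (S.image π)
    have key : Gen k (insert a' (S.image π))
        fun σ : L' → Fin n ⊕ Fin m => f (σ ∘ Function.update π a a') := by
      convert ih (Function.update π a a') using 1
      rw [Finset.image_insert, Function.update_self]
      congr 1
      refine Finset.image_congr fun s hs => ?_
      exact (Function.update_of_ne (ne_of_mem_of_not_mem hs ha) _ _).symm
    convert Gen.sum ha' key using 1
    funext σ
    refine Finset.sum_congr rfl fun u _ => hf.congr fun s hs => ?_
    rcases Finset.mem_insert.1 hs with rfl | hs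
    · simp
    · have h1 : s ≠ a := ne_of_mem_of_not_mem hs ha
      have h2 : π s ≠ a' := by rintro rfl; exact ha' (Finset.mem_image_of_mem _ hs)
      simp [h1, h2]

end Gen

/-! ### Labelled homomorphism polynomials are invariant under counting logic -/

namespace CFormula

variable {k n m : ℕ}

lemma realize_congr (G : WeightedBip n m) (φ : CFormula k)
    {v w : Fin k → Option (Fin n ⊕ Fin m)} (h : ∀ x ∈ φ.freeVars, v x = w x) :
    φ.Realize G v ↔ φ.Realize G w := by
  induction φ generalizing v w with
  | falsum => rfl
  | eq x y => simp only [freeVars, Finset.mem_insert, Finset.mem_singleton, forall_eq_or_imp,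
      forall_eq] at h; simp [Realize, h]
  | inA x => simp only [freeVars, Finset.mem_singleton, forall_eq] at h; simp [Realize, h]
  | inB x => simp only [freeVars, Finset.mem_singleton, forall_eq] at h; simp [Realize, h]
  | rel q x y => simp only [freeVars, Finset.mem_insert, Finset.mem_singleton, forall_eq_or_imp,
      forall_eq] at h; simp [Realize, h]
  | neg φ ih => exact not_congr (ih h)
  | and φ ψ ihφ ihψ =>
    exact and_congr (ihφ fun x hx => h x (Finset.mem_union_left _ hx))
      (ihψ fun x hx => h x (Finset.mem_union_right _ hx))
  | existsGe i x φ ih =>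
    have key : ∀ a, φ.Realize G (Function.update v x (some a)) ↔
        φ.Realize G (Function.update w x (some a)) := fun a => ih fun y hy => by
      by_cases hyx : y = x
      · subst hyx; simp
      · simp [hyx, h y (Finset.mem_erase.2 ⟨hyx, hy⟩)]
    simp only [Realize, key]

/-- Two structures with partial assignments satisfy the same formulas whose free variables lie in
`D`. -/
def Indist (D : Finset (Fin k)) (G H : WeightedBip n m)
    (v w : Fin k → Option (Fin n ⊕ Fin m)) : Prop :=
  ∀ φ : CFormula k, φ.freeVars ⊆ D → (φ.Realize G v ↔ φ.Realize H w)

/-- Within a finite family of structures with assignments, each type is defined by a single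
formula. -/
lemma exists_isolating {ι : Type*} [Finite ι] (D : Finset (Fin k)) (G : ι → WeightedBip n m)
    (v : ι → Fin k → Option (Fin n ⊕ Fin m)) (i : ι) :
    ∃ χ : CFormula k, χ.freeVars ⊆ D ∧
      ∀ j, χ.Realize (G j) (v j) ↔ Indist D (G i) (G j) (v i) (v j) := by
  classical
  have := Fintype.ofFinite ι
  have key : ∀ s : Finset ι, ∃ χ : CFormula k, χ.freeVars ⊆ D ∧ χ.Realize (G i) (v i) ∧
      ∀ j ∈ s, χ.Realize (G j) (v j) → Indist D (G i) (G j) (v i) (v j) := by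
    intro s
    induction s using Finset.induction_on with
    | empty => exact ⟨.neg .falsum, by simp [freeVars], by simp [Realize], by simp⟩
    | insert j s hj ih =>
      obtain ⟨χ, h1, h2, h3⟩ := ih
      by_cases hD : Indist D (G i) (G j) (v i) (v j)
      · refine ⟨χ, h1, h2, fun l hl hχ => ?_⟩
        rcases Finset.mem_insert.1 hl with rfl | hl
        exacts [hD, h3 l hl hχ]
      · have : ∃ ψ : CFormula k, ψ.freeVars ⊆ D ∧ ψ.Realize (G i) (v i) ∧
            ¬ ψ.Realize (G j) (v j) := by
          simp only [Indist, not_forall] at hD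
          obtain ⟨φ, hφ, hne⟩ := hD
          by_cases h : φ.Realize (G i) (v i)
          · exact ⟨φ, hφ, h, by tauto⟩
          · exact ⟨.neg φ, hφ, h, by simp only [Realize]; tauto⟩
        obtain ⟨ψ, g1, g2, g3⟩ := this
        refine ⟨.and χ ψ, Finset.union_subset h1 g1, ⟨h2, g2⟩, fun l hl hχ => ?_⟩
        rcases Finset.mem_insert.1 hl with rfl | hl
        exacts [absurd hχ.2 g3, h3 l hl hχ.1]
  obtain ⟨χ, h1, h2, h3⟩ := key Finset.univ
  exact ⟨χ, h1, fun j => ⟨h3 j (Finset.mem_univ j), fun h => (h χ h1).1 h2⟩⟩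

/-- Counting quantifiers yield a bijection of the universes which preserves types: this is a round
of the bijective pebble game. -/
lemma Indist.exists_equiv {D : Finset (Fin k)} {G H : WeightedBip n m}
    {v w : Fin k → Option (Fin n ⊕ Fin m)} (h : Indist D G H v w) (x : Fin k) :
    ∃ e : Fin n ⊕ Fin m ≃ Fin n ⊕ Fin m, ∀ u, Indist (insert x D) G H
      (Function.update v x (some u)) (Function.update w x (some (e u))) := by
  classical
  let tp (G : WeightedBip n m) (v : Fin k → Option (Fin n ⊕ Fin m)) (u : Fin n ⊕ Fin m) :
      Set (CFormula k) :=
    {φ | φ.freeVars ⊆ insert x D ∧ φ.Realize G (Function.update v x (some u))}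
  have tp_eq : ∀ (G₁ G₂ : WeightedBip n m) v₁ v₂ u₁ u₂, tp G₁ v₁ u₁ = tp G₂ v₂ u₂ ↔
      Indist (insert x D) G₁ G₂ (Function.update v₁ x (some u₁))
        (Function.update v₂ x (some u₂)) := by
    intro G₁ G₂ v₁ v₂ u₁ u₂
    simp only [tp, Set.ext_iff, Set.mem_ofPred_eq, and_congr_right_iff, Indist]
  let 𝒢 : (Fin n ⊕ Fin m) ⊕ (Fin n ⊕ Fin m) → WeightedBip n m :=
    Sum.elim (fun _ => G) (fun _ => H)
  let 𝓋 : (Fin n ⊕ Fin m) ⊕ (Fin n ⊕ Fin m) → Fin k → Option (Fin n ⊕ Fin m) :=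
    Sum.elim (fun u => Function.update v x (some u)) (fun u => Function.update w x (some u))
  have hcard : ∀ χ : CFormula k, χ.freeVars ⊆ insert x D →
      {u | χ.Realize G (Function.update v x (some u))}.ncard =
        {u | χ.Realize H (Function.update w x (some u))}.ncard := by
    intro χ hχ
    have hs : ∀ c, (existsGe c x χ).freeVars ⊆ D := fun c => by
      simpa [freeVars, Finset.subset_insert_iff] using hχ
    exact le_antisymm ((h _ (hs _)).1 le_rfl) ((h _ (hs _)).2 le_rfl)
  have hfib : ∀ T : Set (CFormula k),
      Nonempty ({u // tp G v u = T} ≃ {u // tp H w u = T}) := by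
    intro T
    by_cases hT : ∃ i, tp (𝒢 i) (Sum.elim (fun _ => v) (fun _ => w) i) (Sum.elim id id i) = T
    · obtain ⟨i, rfl⟩ := hT
      obtain ⟨χ, hχ, hiso⟩ := exists_isolating (insert x D) 𝒢 𝓋 i
      have e1 : {u | χ.Realize G (Function.update v x (some u))} =
          {u | tp G v u = tp (𝒢 i) (Sum.elim (fun _ => v) (fun _ => w) i) (Sum.elim id id i)} := by
        ext u
        rw [Set.mem_ofPred_eq, Set.mem_ofPred_eq, eq_comm, tp_eq]
        cases i <;> exact hiso (.inl u)
      have e2 : {u | χ.Realize H (Function.update w x (some u))} =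
          {u | tp H w u = tp (𝒢 i) (Sum.elim (fun _ => v) (fun _ => w) i) (Sum.elim id id i)} := by
        ext u
        rw [Set.mem_ofPred_eq, Set.mem_ofPred_eq, eq_comm, tp_eq]
        cases i <;> exact hiso (.inr u)
      have := hcard χ hχ
      rw [e1, e2] at this
      exact Finite.card_eq.1 this
    · push Not at hT
      have h1 : IsEmpty {u // tp G v u = T} := ⟨fun u => hT (.inl u) u.2⟩
      have h2 : IsEmpty {u // tp H w u = T} := ⟨fun u => hT (.inr u) u.2⟩
      exact ⟨Equiv.equivOfIsEmpty _ _⟩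
  refine ⟨Equiv.ofFiberEquiv fun T => (hfib T).some, fun u => ?_⟩
  rw [← tp_eq]
  exact (Equiv.ofFiberEquiv_map _ u).symm

end CFormula

section

variable {n m k : ℕ} {L : Type} {S T : Finset L}
  {G H : WeightedBip n m} {σ τ : L → Fin n ⊕ Fin m}

/-- The placements `σ` in `G` and `τ` in `H` of the labelled vertices in `S` satisfy the same
formulas, for some naming of exactly these vertices by the `k` variables. -/
def LabelIndist (k : ℕ) (S : Finset L) (G H : WeightedBip n m) (σ τ : L → Fin n ⊕ Fin m) : Prop :=
  ∃ ℓ : Fin k → Option L, (∀ s, s ∈ S ↔ ∃ x, ℓ x = some s) ∧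
    CFormula.Indist (Finset.univ.filter fun x => (ℓ x).isSome) G H
      (fun x => (ℓ x).map σ) (fun x => (ℓ x).map τ)

/-- Evaluation of an atom is determined by the atomic formulas. -/
lemma LabelIndist.eval_atom (h : LabelIndist k S G H σ τ) (α : Atom L) (hα : α.verts ⊆ S) :
    evalAt (α.eval σ) G = evalAt (α.eval τ) H := by
  obtain ⟨ℓ, hℓ, hI⟩ := h
  cases α with
  | edge a b =>
    obtain ⟨x, hx⟩ := (hℓ a).1 (hα (by simp [Atom.verts]))
    obtain ⟨y, hy⟩ := (hℓ b).1 (hα (by simp [Atom.verts]))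
    have := fun q => hI (.rel q x y) (by
      intro z hz
      rcases Finset.mem_insert.1 hz with rfl | hz
      · simp [hx]
      · rw [Finset.mem_singleton.1 hz]; simp [hy])
    simp only [CFormula.Realize, hx, hy, Option.map_some, Option.some.injEq] at this
    rcases hσa : σ a with i | i <;> rcases hσb : σ b with j | j <;>
    rcases hτa : τ a with i' | i' <;> rcases hτb : τ b with j' | j' <;>
    simp only [hσa, hσb, hτa, hτb, Atom.eval, evalAt, map_zero, MvPolynomial.eval_X] <;>
    simp [hσa, hσb, hτa, hτb] at this
    exact this
  | inA a =>
    obtain ⟨x, hx⟩ := (hℓ a).1 (hα (by simp [Atom.verts]))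
    have := hI (.inA x) (by simp [CFormula.freeVars, hx])
    simp only [CFormula.Realize, hx, Option.map_some, Option.some.injEq] at this
    rcases hσa : σ a with i | i <;> rcases hτa : τ a with i' | i' <;>
    simp [hσa, hτa] at this <;> simp [Atom.eval, hσa, hτa, evalAt]
  | inB a =>
    obtain ⟨x, hx⟩ := (hℓ a).1 (hα (by simp [Atom.verts]))
    have := hI (.inB x) (by simp [CFormula.freeVars, hx])
    simp only [CFormula.Realize, hx, Option.map_some, Option.some.injEq] at this
    rcases hσa : σ a with i | i <;> rcases hτa : τ a with i' | i' <;>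
    simp [hσa, hτa] at this <;> simp [Atom.eval, hσa, hτa, evalAt]

variable [DecidableEq L]

lemma LabelIndist.mono (h : LabelIndist k T G H σ τ) (hST : S ⊆ T) :
    LabelIndist k S G H σ τ := by
  obtain ⟨ℓ, hℓ, hI⟩ := h
  obtain ⟨ℓ', hℓ'⟩ : ∃ ℓ' : Fin k → Option L, ∀ x, ℓ' x = (ℓ x).filter (· ∈ S) := ⟨_, fun _ => rfl⟩
  refine ⟨ℓ', fun s => ?_, fun φ hφ => ?_⟩
  · simp only [hℓ', Option.filter_eq_some_iff, decide_eq_true_eq]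
    constructor
    · intro hs
      obtain ⟨x, hx⟩ := (hℓ s).1 (hST hs)
      exact ⟨x, hx, hs⟩
    · rintro ⟨x, -, hs⟩; exact hs
  · have hx : ∀ x ∈ φ.freeVars, ℓ' x = ℓ x := fun x hx => by
      have := hφ hx
      rw [Finset.mem_filter, Option.isSome_iff_exists] at this
      obtain ⟨-, a, ha⟩ := this
      rw [ha, (Option.filter_eq_some_iff.1 ((hℓ' x).symm.trans ha)).1]
    rw [φ.realize_congr G (w := fun x => (ℓ x).map σ) fun x h => by rw [hx x h],
      φ.realize_congr H (w := fun x => (ℓ x).map τ) fun x h => by rw [hx x h]]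
    refine hI φ fun x h => ?_
    simpa [hx x h] using hφ h

lemma LabelIndist.exists_equiv {a : L} (h : LabelIndist k S G H σ τ) (ha : a ∉ S)
    (hk : (insert a S).card ≤ k) :
    ∃ e : Fin n ⊕ Fin m ≃ Fin n ⊕ Fin m, ∀ u,
      LabelIndist k (insert a S) G H (Function.update σ a u) (Function.update τ a (e u)) := by
  obtain ⟨ℓ, hℓ, hI⟩ := h
  choose g hg using fun s : S => (hℓ s).1 s.2
  -- fewer than `k` vertices are labelled, so some variable is not needed to name them
  obtain ⟨x, hx⟩ : ∃ x, x ∉ Finset.univ.image g := by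
    by_contra! hall
    have h1 : (Finset.univ.image g).card = k := by
      rw [Finset.eq_univ_iff_forall.2 hall, Finset.card_univ, Fintype.card_fin]
    have h2 : (Finset.univ.image g).card ≤ S.card := by
      simpa using Finset.card_image_le (s := Finset.univ) (f := g)
    rw [Finset.card_insert_of_notMem ha] at hk
    omega
  have hx' : ∀ s, g s ≠ x := fun s hs => hx (by simp [← hs])
  obtain ⟨e, he⟩ := hI.exists_equiv x
  have hval : ∀ (ρ : L → Fin n ⊕ Fin m) u, (fun y => (Function.update ℓ x (some a) y).map
      (Function.update ρ a u)) = Function.update (fun y => (ℓ y).map ρ) x (some u) := by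
    intro ρ u
    funext y
    by_cases hy : y = x
    · subst hy; simp
    · simp only [Function.update_of_ne hy]
      rcases hs : ℓ y with _ | s
      · rfl
      · have : s ≠ a := ne_of_mem_of_not_mem ((hℓ s).2 ⟨y, hs⟩) ha
        simp [this]
  refine ⟨e, fun u => ⟨Function.update ℓ x (some a), fun s => ?_, ?_⟩⟩
  · constructor
    · intro hs
      rcases Finset.mem_insert.1 hs with rfl | hs
      · exact ⟨x, by simp⟩
      · exact ⟨g ⟨s, hs⟩, by rw [Function.update_of_ne (hx' _), hg]⟩
    · rintro ⟨y, hy⟩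
      by_cases hyx : y = x
      · subst hyx
        simp at hy
        simp [hy]
      · rw [Function.update_of_ne hyx] at hy
        exact Finset.mem_insert_of_mem ((hℓ s).2 ⟨y, hy⟩)
  · rw [hval, hval]
    intro φ hφ
    refine he u φ (hφ.trans fun y hy => ?_)
    by_cases hyx : y = x
    · simp [hyx]
    · simpa [hyx] using hy

lemma Gen.eval_eq {f : (L → Fin n ⊕ Fin m) → MvPolynomial (Fin n × Fin m) ℚ} (hf : Gen k S f)
    (h : LabelIndist k S G H σ τ) : evalAt (f σ) G = evalAt (f τ) H := by
  induction hf generalizing σ τ with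
  | one => simp [evalAt]
  | atom _ α hα => exact h.eval_atom α hα
  | mul hST _ _ ihf ihg =>
    have h1 := ihf (h.mono hST)
    have h2 := ihg h
    simp only [evalAt] at h1 h2 ⊢
    simp [h1, h2]
  | @sum S a f ha hf ih =>
    obtain ⟨e, he⟩ := h.exists_equiv ha hf.card_le
    simp only [evalAt, map_sum]
    exact Fintype.sum_equiv e _ _ fun u => ih (he u)

end

lemma CEquiv.labelIndist {n m k : ℕ} {L : Type} {G H : WeightedBip n m} (h : CEquiv k G H)
    (σ τ : L → Fin n ⊕ Fin m) : LabelIndist k ∅ G H σ τ :=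
  ⟨fun _ => none, by simp, fun φ hφ => h φ (by simpa [CFormula.IsSentence] using hφ)⟩

/-- A polynomial given by a graph without labels has the same value on `C^k`-equivalent graphs. -/
lemma Gen.evalAt_eq_of_cEquiv {n m k : ℕ} {L : Type} [DecidableEq L]
    {G H : WeightedBip n m} [Nonempty (Fin n ⊕ Fin m)] {q : MvPolynomial (Fin n × Fin m) ℚ}
    (hq : Gen k (∅ : Finset L) fun _ => q) (h : CEquiv k G H) : evalAt q G = evalAt q H :=
  hq.eval_eq (σ := fun _ => Classical.arbitrary _) (τ := fun _ => Classical.arbitrary _)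
    (h.labelIndist _ _)

/-! ### Variable elimination along a tree decomposition -/

lemma SimpleGraph.Walk.IsPath.exists_of_induce {N : Type} {T : SimpleGraph N} {s : Set N} {u v : s}
    {w : (T.induce s).Walk u v} (hw : w.IsPath) :
    ∃ w' : T.Walk u v, w'.IsPath ∧ ∀ r, r ∈ w'.support ↔ ∃ r' ∈ w.support, (r' : N) = r :=
  ⟨w.map (SimpleGraph.Embedding.induce s).toHom, hw.map Subtype.val_injective, fun r =>
    (iff_of_eq (congrArg (r ∈ ·) (SimpleGraph.Walk.support_map _ w))).trans List.mem_map⟩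

section

variable {n m k : ℕ} {L : Type} [DecidableEq L] [Fintype L] {S : Finset L}
  {f g : (L → Fin n ⊕ Fin m) → MvPolynomial (Fin n × Fin m) ℚ}

/-- Summing out one vertex. Summation over all placements is unchanged up to a scalar when a
single vertex is averaged first. -/
lemma sum_mul_eq_smul_sum_update [Nonempty (Fin n ⊕ Fin m)] (a : L)
    (hg : ∀ σ u, g (Function.update σ a u) = g σ) :
    ∑ σ, f σ * g σ =
      (Fintype.card (Fin n ⊕ Fin m) : ℚ)⁻¹ • ∑ σ, (∑ u, f (Function.update σ a u)) * g σ := by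
  have hN : (Fintype.card (Fin n ⊕ Fin m) : ℚ) ≠ 0 := by
    exact_mod_cast Fintype.card_ne_zero
  rw [eq_inv_smul_iff₀ hN]
  -- exchanging the old and the new position of `a` is an involution of the index set
  let e : (L → Fin n ⊕ Fin m) × (Fin n ⊕ Fin m) ≃ (L → Fin n ⊕ Fin m) × (Fin n ⊕ Fin m) :=
    { toFun := fun p => (Function.update p.1 a p.2, p.1 a)
      invFun := fun p => (Function.update p.1 a p.2, p.1 a)
      left_inv := fun p => by simp
      right_inv := fun p => by simp }
  calc _ = ∑ p : (L → Fin n ⊕ Fin m) × (Fin n ⊕ Fin m), f p.1 * g p.1 := by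
        rw [Fintype.sum_prod_type]
        simp only [Finset.sum_const, Finset.card_univ, ← Finset.smul_sum, Nat.cast_smul_eq_nsmul]
    _ = ∑ p : (L → Fin n ⊕ Fin m) × (Fin n ⊕ Fin m), f (Function.update p.1 a p.2) * g p.1 := by
        refine (Fintype.sum_equiv e _ _ fun p => ?_).symm
        simp [e, hg]
    _ = _ := by
        rw [Fintype.sum_prod_type]
        simp only [Finset.sum_mul]

/-- Summing out a set of vertices that do not occur in the remaining factor `g`. -/
lemma Gen.exists_eliminate [Nonempty (Fin n ⊕ Fin m)] (W : Finset L) (hf : Gen k S f)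
    (hg : ∀ a ∈ W, ∀ σ u, g (Function.update σ a u) = g σ) :
    ∃ (c : ℚ) (f' : _), Gen k (S \ W) f' ∧ ∑ σ, f σ * g σ = c • ∑ σ, f' σ * g σ := by
  induction W using Finset.induction_on generalizing S f with
  | empty => exact ⟨1, f, by simpa using hf, by simp⟩
  | insert a W ha ih =>
    by_cases haS : a ∈ S
    · have h1 : Gen k (S.erase a) fun σ => ∑ u, f (Function.update σ a u) :=
        .sum (Finset.notMem_erase a S) (by rwa [Finset.insert_erase haS])
      obtain ⟨c, f', hf', hc⟩ := ih h1 fun b hb => hg b (Finset.mem_insert_of_mem hb)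
      refine ⟨(Fintype.card (Fin n ⊕ Fin m) : ℚ)⁻¹ * c, f', ?_, ?_⟩
      · rwa [Finset.sdiff_insert, ← Finset.erase_sdiff_comm]
      · rw [sum_mul_eq_smul_sum_update a (hg a (Finset.mem_insert_self a W)), hc, smul_smul]
    · obtain ⟨c, f', hf', hc⟩ := ih hf fun b hb => hg b (Finset.mem_insert_of_mem hb)
      refine ⟨c, f', ?_, hc⟩
      rwa [Finset.sdiff_insert_of_notMem haS]

/-- Variable elimination: a sum over all placements of a product of factors attached to the bags
of a tree decomposition reduces, up to a scalar, to a polynomial generated without labels.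
That the bags containing a given vertex form a subtree is expressed through paths, so that
the condition is visibly inherited when a leaf is removed. -/
lemma exists_gen_of_tree [Nonempty (Fin n ⊕ Fin m)] {N : Type} [Fintype N] (T : SimpleGraph N)
    (hT : T.IsTree) (bag : N → Finset L)
    (hbag : ∀ v s t (p : T.Walk s t), p.IsPath → v ∈ bag s → v ∈ bag t →
      ∀ r ∈ p.support, v ∈ bag r)
    (F : N → (L → Fin n ⊕ Fin m) → MvPolynomial (Fin n × Fin m) ℚ)
    (hF : ∀ t, Gen k (bag t) (F t)) :
    ∃ (c : ℚ) (q : MvPolynomial (Fin n × Fin m) ℚ),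
      Gen k (∅ : Finset L) (fun _ => q) ∧ ∑ σ, ∏ t, F t σ = c • q := by
  classical
  induction hN : Fintype.card N using Nat.strong_induction_on generalizing N with
  | _ N' ih =>
  subst hN
  have hne := hT.connected.nonempty
  rcases subsingleton_or_nontrivial N with hs | hn
  · obtain ⟨r⟩ := hne
    have : Unique N := ⟨⟨r⟩, fun _ => Subsingleton.elim _ _⟩
    obtain ⟨c, f', hf', hc⟩ := (hF r).exists_eliminate (g := 1) (bag r) (by simp)
    rw [Finset.sdiff_self] at hf'
    let σ₀ : L → Fin n ⊕ Fin m := fun _ => Classical.arbitrary _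
    have hconst : ∀ σ, f' σ = f' σ₀ := fun σ => hf'.congr (by simp)
    refine ⟨c * Fintype.card (L → Fin n ⊕ Fin m), f' σ₀, ?_, ?_⟩
    · convert hf' using 1
      exact (funext hconst).symm
    · have hd : (default : N) = r := Subsingleton.elim _ _
      simp only [Fintype.prod_unique, hd]
      simp only [Pi.one_apply, mul_one] at hc
      rw [hc, Finset.sum_congr rfl fun σ _ => hconst σ]
      rw [Finset.sum_const, Finset.card_univ, ← Nat.cast_smul_eq_nsmul ℚ, smul_smul]
  · obtain ⟨l, hl⟩ := hT.exists_vert_degree_one_of_nontrivial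
    obtain ⟨p, hlp, hp⟩ := SimpleGraph.degree_eq_one_iff_existsUnique_adj.1 hl
    -- a vertex of the leaf bag which occurs elsewhere also occurs in the neighbouring bag
    have hleaf : ∀ v ∈ bag l, ∀ t, t ≠ l → v ∈ bag t → v ∈ bag p := by
      intro v hv t ht hvt
      obtain ⟨w, hw⟩ := hT.connected.exists_isPath l t
      have hnil : ¬ w.Nil := SimpleGraph.Walk.not_nil_of_ne ht.symm
      rw [← hp _ (w.adj_snd hnil)]
      exact hbag v l t w hw hv hvt _ (w.getVert_mem_support 1)
    have hpl : p ≠ l := hlp.ne'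
    let N₁ := {t // t ∈ ({l}ᶜ : Set N)}
    let p₁ : N₁ := ⟨p, by simpa using hpl⟩
    have hprod : ∀ Φ : N → MvPolynomial (Fin n × Fin m) ℚ,
        ∏ t, Φ t = Φ l * ∏ t : N₁, Φ t := by
      intro Φ
      rw [Fintype.prod_eq_mul_prod_compl l]
      congr 1
      exact Finset.prod_subtype _ (by simp) _
    obtain ⟨c, f', hf', hc⟩ := (hF l).exists_eliminate (g := fun σ => ∏ t : N₁, F t σ)
      (bag l \ bag p) (by
        intro a ha σ u
        refine Finset.prod_congr rfl fun t _ => (hF t).congr fun s hs => ?_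
        rw [Function.update_of_ne]
        rintro rfl
        rw [Finset.mem_sdiff] at ha
        exact ha.2 (hleaf _ ha.1 t t.2 hs))
    have hf'p : Gen k (bag p) (f' * F p) := by
      refine .mul (fun v hv => ?_) hf' (hF p)
      simp only [Finset.mem_sdiff, not_and, not_not] at hv
      exact hv.2 hv.1
    have hT₁ : (T.induce ({l}ᶜ : Set N)).IsTree :=
      ⟨hT.connected.induce_compl_singleton_of_degree_eq_one hl, hT.isAcyclic.induce _⟩
    obtain ⟨c', q, hq, hqc⟩ := ih (Fintype.card N₁)
      (Fintype.card_subtype_lt (x := l) (by simp)) (T.induce ({l}ᶜ : Set N)) hT₁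
      (fun t => bag t) (by
        intro v s t w hw hs ht r hr
        obtain ⟨w', hw', hsupp⟩ := hw.exists_of_induce
        exact hbag v s t w' hw' hs ht r ((hsupp r).2 ⟨r, hr, rfl⟩))
      (fun t => if t = p₁ then f' * F p else F t) (by
        intro t
        by_cases h : t = p₁
        · subst h; simpa using hf'p
        · simpa [h] using hF t) rfl
    refine ⟨c * c', q, hq, ?_⟩
    rw [mul_smul, ← hqc]
    simp only [hprod]
    rw [hc]
    congr 1
    refine Finset.sum_congr rfl fun σ _ => ?_
    rw [Fintype.prod_eq_mul_prod_compl p₁, Fintype.prod_eq_mul_prod_compl p₁ (fun t => _)]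
    simp only [if_true, Pi.mul_apply, mul_assoc]
    congr 2
    refine Finset.prod_congr rfl fun t ht => ?_
    rw [if_neg (by simpa using ht)]

end

lemma Gen.multiset_prod {n m k : ℕ} {L : Type} [DecidableEq L] {S : Finset L} (hS : S.card ≤ k)
    (M : Multiset (Atom L)) (hM : ∀ α ∈ M, α.verts ⊆ S) :
    Gen k S fun σ : L → Fin n ⊕ Fin m => (M.map fun α => α.eval σ).prod := by
  induction M using Multiset.induction_on with
  | empty => exact Gen.one hS
  | cons α M ih =>
    simp only [Multiset.map_cons, Multiset.prod_cons]
    exact Gen.mul subset_rfl (.atom hS α (hM α (by simp)))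
      (ih fun β hβ => hM β (Multiset.mem_cons_of_mem hβ))

namespace BipMultigraph

variable (F : BipMultigraph) {n m k : ℕ}

/-- The trivial tree decomposition with a single bag. -/
def trivialDecomposition : F.TreeDecomposition where
  Node := Unit
  tree := ⊥
  isTree := .of_subsingleton
  bag _ := Finset.univ
  vertex_covered v := ⟨(), Finset.mem_univ v⟩
  edge_covered e _ := ⟨(), Finset.mem_univ _, Finset.mem_univ _⟩
  connected v := by
    have : Nonempty {t : Unit | v ∈ (Finset.univ : Finset F.V)} := ⟨⟨(), Finset.mem_univ v⟩⟩
    exact (SimpleGraph.IsTree.of_subsingleton).connected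

lemma treewidth_lt_iff : F.treewidth < k ↔ ∃ D : F.TreeDecomposition, ∀ t, (D.bag t).card ≤ k := by
  have hw : ∀ D : F.TreeDecomposition, D.width < k ↔ ∀ t, (D.bag t).card ≤ k := fun D => by
    rw [TreeDecomposition.width, sub_lt_iff_lt_add, Int.lt_add_one_iff, Nat.cast_le,
      Finset.sup_le_iff]
    simp
  have hne : (Set.range fun D : F.TreeDecomposition => D.width).Nonempty :=
    ⟨_, F.trivialDecomposition, rfl⟩
  constructor
  · intro h
    obtain ⟨_, ⟨D, rfl⟩, hD⟩ := exists_lt_of_csInf_lt hne h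
    exact ⟨D, (hw D).1 hD⟩
  · rintro ⟨D, hD⟩
    refine lt_of_le_of_lt (csInf_le ⟨-1, ?_⟩ ⟨D, rfl⟩) ((hw D).2 hD)
    rintro _ ⟨D, rfl⟩
    simp only [TreeDecomposition.width]
    omega

/-- The atoms requiring a placement to respect the bipartition. -/
def sideAtom : F.V → Atom F.V
  | .inl a => .inA (.inl a)
  | .inr b => .inB (.inr b)

/-- The homomorphism polynomial as a sum over all placements of the vertices, where those not
respecting the bipartition contribute zero. -/
lemma homPoly_eq_sum_atoms : F.homPoly n m = ∑ σ : F.V → Fin n ⊕ Fin m,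
    (∏ v, (F.sideAtom v).eval σ) *
      (F.E.map fun e => (Atom.edge (.inl e.1) (.inr e.2) : Atom F.V).eval σ).prod := by
  classical
  rw [homPoly, ← Fintype.sum_prod_type']
  refine Fintype.sum_of_injective (fun p : (F.A → Fin n) × (F.B → Fin m) => Sum.map p.1 p.2)
    ?_ _ _ ?_ ?_
  · rintro ⟨f, g⟩ ⟨f', g'⟩ h
    refine Prod.ext (funext fun a => ?_) (funext fun b => ?_)
    · simpa using congrFun h (.inl a)
    · simpa using congrFun h (.inr b)
  · intro σ hσ
    have : ∃ v, (F.sideAtom v).eval σ = 0 := by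
      by_contra! hall
      have hA : ∀ a, ∃ i, σ (.inl a) = .inl i := fun a => by
        have := hall (.inl a)
        rcases h : σ (.inl a) with i | i
        · exact ⟨i, rfl⟩
        · simp [sideAtom, Atom.eval, h] at this
      have hB : ∀ b, ∃ i, σ (.inr b) = .inr i := fun b => by
        have := hall (.inr b)
        rcases h : σ (.inr b) with i | i
        · simp [sideAtom, Atom.eval, h] at this
        · exact ⟨i, rfl⟩
      choose f hf using hA
      choose g hg using hB
      refine hσ ⟨(f, g), funext fun v => ?_⟩
      rcases v with a | b
      · simp [hf]
      · simp [hg]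
    obtain ⟨v, hv⟩ := this
    rw [Finset.prod_eq_zero (Finset.mem_univ v) hv, zero_mul]
  · rintro ⟨f, g⟩
    rw [Finset.prod_eq_one, one_mul]
    · rfl
    · rintro (a | b) - <;> rfl

/-- The homomorphism polynomial of a graph of treewidth less than `k` is generated within
bags of size `k`. -/
lemma exists_gen_of_treewidth_lt [Nonempty (Fin n ⊕ Fin m)] (hF : F.treewidth < k) :
    ∃ (c : ℚ) (q : MvPolynomial (Fin n × Fin m) ℚ),
      Gen k (∅ : Finset F.V) (fun _ => q) ∧ F.homPoly n m = c • q := by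
  classical
  obtain ⟨D, hD⟩ := F.treewidth_lt_iff.1 hF
  -- every vertex and every edge is assigned to one bag containing it
  choose tv htv using D.vertex_covered
  have he : ∀ e : F.A × F.B, ∃ t, e ∈ F.E →
      (Sum.inl e.1 : F.V) ∈ D.bag t ∧ (Sum.inr e.2 : F.V) ∈ D.bag t := fun e => by
    by_cases h : e ∈ F.E
    · obtain ⟨t, ht⟩ := D.edge_covered e h
      exact ⟨t, fun _ => ht⟩
    · exact ⟨D.isTree.connected.nonempty.some, fun h' => absurd h' h⟩
  choose te hte using he
  let M : D.Node → Multiset (Atom F.V) := fun t =>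
    (Finset.univ.filter fun v => tv v = t).val.map F.sideAtom +
      (F.E.filter fun e => te e = t).map fun e => .edge (.inl e.1) (.inr e.2)
  have hM : ∀ t, ∀ α ∈ M t, α.verts ⊆ D.bag t := by
    intro t α hα
    rcases Multiset.mem_add.1 hα with h | h
    · obtain ⟨v, hv, rfl⟩ := Multiset.mem_map.1 h
      obtain rfl : tv v = t := by simpa using hv
      have := htv v
      rcases v with a | b <;> simpa [sideAtom, Atom.verts] using this
    · obtain ⟨e, he, rfl⟩ := Multiset.mem_map.1 h
      obtain ⟨heE, rfl⟩ := Multiset.mem_filter.1 he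
      have := hte e heE
      simp [Atom.verts, Set.insert_subset_iff, this]
  obtain ⟨c, q, hq, hc⟩ := exists_gen_of_tree (n := n) (m := m) D.tree D.isTree D.bag (by
    intro v s t w hw hs ht r hr
    obtain ⟨w', hw'⟩ := (D.connected v).exists_isPath ⟨s, hs⟩ ⟨t, ht⟩
    obtain ⟨w'', hw'', hsupp⟩ := hw'.exists_of_induce
    rw [(D.isTree.existsUnique_path s t).unique hw hw''] at hr
    obtain ⟨r', -, rfl⟩ := (hsupp r).1 hr
    exact r'.2) _ fun t => Gen.multiset_prod (hD t) (M t) (hM t)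
  refine ⟨c, q, hq, ?_⟩
  rw [← hc, homPoly_eq_sum_atoms]
  refine Finset.sum_congr rfl fun σ _ => ?_
  simp only [M, Multiset.map_add, Multiset.prod_add, Multiset.map_map, Finset.prod_mul_distrib]
  congr 1
  · exact (Finset.prod_fiberwise _ tv _).symm
  · induction F.E using Multiset.induction_on with
    | empty => simp
    | cons e E ih =>
      simp only [Multiset.filter_cons, Multiset.map_add, Multiset.prod_add,
        Finset.prod_mul_distrib, Multiset.map_cons, Multiset.prod_cons, ← ih]
      congr 1
      rw [Fintype.prod_eq_single (te e)]
      · simp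
      · intro t ht
        simp [ht.symm]

end BipMultigraph

/-! ### Labelled graphs with rooted tree decompositions -/

namespace SimpleGraph

variable {N₁ N₂ : Type} {T₁ : SimpleGraph N₁} {T₂ : SimpleGraph N₂} {r₁ : N₁} {r₂ : N₂}

/-- Joining two trees by an edge gives a tree. -/
lemma IsTree.sum_sup_edge [Finite N₁] [Finite N₂] (h₁ : T₁.IsTree) (h₂ : T₂.IsTree) :
    (T₁.sum T₂ ⊔ edge (.inl r₁) (.inr r₂)).IsTree := by
  rw [isTree_iff_connected_and_card] at h₁ h₂ ⊢
  refine ⟨h₁.1.sum_sup_edge h₂.1, ?_⟩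
  have hcard : Nat.card (T₁.sum T₂).edgeSet = Nat.card T₁.edgeSet + Nat.card T₂.edgeSet := by
    rw [Nat.card_congr edgeSetSumEquiv, Nat.card_sum]
  rw [Nat.card_sum, ← h₁.2, ← h₂.2, edgeSet_sup, edgeSet_edge_of_ne (by simp), Set.union_singleton,
    Nat.card_coe_set_eq, Set.ncard_insert_of_notMem (by simp), ← Nat.card_coe_set_eq, hcard]
  omega

/-- Subtrees of the two trees span a subtree of the join if they contain the joined vertices, or
if one of them is empty. -/
lemma Preconnected.induce_sum_sup_edge {P : Set (N₁ ⊕ N₂)}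
    (h₁ : (T₁.induce (Sum.inl ⁻¹' P)).Preconnected)
    (h₂ : (T₂.induce (Sum.inr ⁻¹' P)).Preconnected)
    (hr : ∀ t₁ t₂, Sum.inl t₁ ∈ P → Sum.inr t₂ ∈ P → Sum.inl r₁ ∈ P ∧ Sum.inr r₂ ∈ P) :
    ((T₁.sum T₂ ⊔ edge (.inl r₁) (.inr r₂)).induce P).Preconnected := by
  set T := T₁.sum T₂ ⊔ edge (.inl r₁) (.inr r₂) with hT
  let φ₁ : T₁.induce (Sum.inl ⁻¹' P) →g T.induce P :=
    { toFun := fun x => ⟨.inl x, x.2⟩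
      map_rel' := fun {x y} h => by
        have : T₁.Adj x y := h
        simp [hT, this] }
  let φ₂ : T₂.induce (Sum.inr ⁻¹' P) →g T.induce P :=
    { toFun := fun x => ⟨.inr x, x.2⟩
      map_rel' := fun {x y} h => by
        have : T₂.Adj x y := h
        simp [hT, this] }
  have key : ∀ t₁ t₂ (h1 : Sum.inl t₁ ∈ P) (h2 : Sum.inr t₂ ∈ P),
      (T.induce P).Reachable ⟨.inl t₁, h1⟩ ⟨.inr t₂, h2⟩ := by
    intro t₁ t₂ h1 h2
    obtain ⟨hr₁, hr₂⟩ := hr t₁ t₂ h1 h2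
    have e1 := (h₁ ⟨t₁, h1⟩ ⟨r₁, hr₁⟩).map φ₁
    have e2 := (h₂ ⟨r₂, hr₂⟩ ⟨t₂, h2⟩).map φ₂
    have e3 : (T.induce P).Adj ⟨.inl r₁, hr₁⟩ ⟨.inr r₂, hr₂⟩ := by
      simp [hT, edge_adj]
    exact (e1.trans e3.reachable).trans e2
  rintro ⟨t₁ | t₁, h1⟩ ⟨t₂ | t₂, h2⟩
  · exact (h₁ ⟨t₁, h1⟩ ⟨t₂, h2⟩).map φ₁
  · exact key _ _ h1 h2
  · exact (key _ _ h2 h1).symm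
  · exact (h₂ ⟨t₁, h1⟩ ⟨t₂, h2⟩).map φ₂

end SimpleGraph

/-- A finite graph of atoms on labelled vertices `L` and unlabelled vertices `I`, with a rooted tree
decomposition into bags of size at most `k` whose root bag contains the set `S` of labels, no other
label being used. -/
structure LabelledGraph {L : Type} [DecidableEq L] (k : ℕ) (S : Finset L) where
  I : Type
  [fintypeI : Fintype I]
  [decEqI : DecidableEq I]
  atoms : Multiset (Atom (L ⊕ I))
  Node : Type
  [fintypeNode : Fintype Node]
  tree : SimpleGraph Node
  isTree : tree.IsTree
  root : Node
  bag : Node → Finset (L ⊕ I)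
  card_bag : ∀ t, (bag t).card ≤ k
  root_bag : ∀ s ∈ S, Sum.inl s ∈ bag root
  label_mem : ∀ t s, Sum.inl s ∈ bag t → s ∈ S
  vertex_covered : ∀ i, ∃ t, Sum.inr i ∈ bag t
  atom_covered : ∀ α ∈ atoms, ∃ t, α.verts ⊆ bag t
  connected : ∀ v, (tree.induce {t | v ∈ bag t}).Preconnected

attribute [instance] LabelledGraph.fintypeI LabelledGraph.decEqI LabelledGraph.fintypeNode

namespace LabelledGraph

variable {L : Type} [DecidableEq L] {k n m : ℕ} {S T : Finset L}

/-- The sum over all positions of the unlabelled vertices, the labelled ones being placed by `σ`. -/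
noncomputable def value (F : LabelledGraph k S) (σ : L → Fin n ⊕ Fin m) :
    MvPolynomial (Fin n × Fin m) ℚ :=
  ∑ h : F.I → Fin n ⊕ Fin m, (F.atoms.map fun α => α.eval (Sum.elim σ h)).prod

/-- Labelled vertices only, in a single bag. -/
def single (hS : S.card ≤ k) (M : Multiset (Atom L)) (hM : ∀ α ∈ M, α.verts ⊆ S) :
    LabelledGraph k S where
  I := Empty
  atoms := M.map (Atom.map Sum.inl)
  Node := Unit
  tree := ⊥
  isTree := .of_subsingleton
  root := ()
  bag _ := S.map ⟨Sum.inl, Sum.inl_injective⟩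
  card_bag _ := by simpa using hS
  root_bag s hs := by simpa using hs
  label_mem _ s hs := by simpa using hs
  vertex_covered i := i.elim
  atom_covered α hα := by
    obtain ⟨β, hβ, rfl⟩ := Multiset.mem_map.1 hα
    refine ⟨(), ?_⟩
    rw [Atom.verts_map, Finset.coe_map]
    exact Set.image_mono (hM β hβ)
  connected v x y := by rw [Subsingleton.elim x y]

lemma value_single (hS : S.card ≤ k) (M : Multiset (Atom L)) (hM : ∀ α ∈ M, α.verts ⊆ S)
    (σ : L → Fin n ⊕ Fin m) :
    (single hS M hM).value σ = (M.map fun α => α.eval σ).prod := by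
  have : Unique (Empty → Fin n ⊕ Fin m) := Pi.uniqueOfIsEmpty _
  simp only [value, single, Multiset.map_map, Function.comp_def, Atom.eval_map, Sum.elim_inl]
  exact Fintype.sum_unique (ι := Empty → Fin n ⊕ Fin m) _

lemma preconnected_image {N V W : Type} [DecidableEq W] {T : SimpleGraph N} {bag : N → Finset V}
    (h : ∀ v, (T.induce {t | v ∈ bag t}).Preconnected) {e : V → W} (he : Function.Injective e)
    (w : W) : (T.induce {t | w ∈ (bag t).image e}).Preconnected := by
  by_cases hw : ∃ v, e v = w
  · obtain ⟨v, rfl⟩ := hw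
    have : {t | e v ∈ (bag t).image e} = {t | v ∈ bag t} :=
      Set.ext fun t => he.mem_finset_image
    rw [this]
    exact h v
  · rintro ⟨t, ht⟩
    obtain ⟨v, -, hv⟩ := Finset.mem_image.1 ht
    exact (hw ⟨v, hv⟩).elim

lemma verts_map_subset {V W : Type} [DecidableEq W] {b : Finset V} {α : Atom V} (e : V → W)
    (h : α.verts ⊆ b) : (α.map e).verts ⊆ b.image e := by
  rw [Atom.verts_map, Finset.coe_image]
  exact Set.image_mono h

/-- Gluing two labelled graphs along their labels. -/
def glue (F : LabelledGraph k S) (G : LabelledGraph k T) (hST : S ⊆ T) : LabelledGraph k T where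
  I := F.I ⊕ G.I
  atoms := F.atoms.map (Atom.map (Sum.map id Sum.inl)) + G.atoms.map (Atom.map (Sum.map id Sum.inr))
  Node := F.Node ⊕ G.Node
  tree := F.tree.sum G.tree ⊔ SimpleGraph.edge (.inl F.root) (.inr G.root)
  isTree := F.isTree.sum_sup_edge G.isTree
  root := .inr G.root
  bag := Sum.elim (fun t => (F.bag t).image (Sum.map id Sum.inl))
    (fun t => (G.bag t).image (Sum.map id Sum.inr))
  card_bag := by
    rintro (t | t)
    · exact Finset.card_image_le.trans (F.card_bag t)
    · exact Finset.card_image_le.trans (G.card_bag t)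
  root_bag s hs := by simpa using G.root_bag s hs
  label_mem := by
    rintro (t | t) s hs
    · exact hST (F.label_mem t s (by simpa using hs))
    · exact G.label_mem t s (by simpa using hs)
  vertex_covered := by
    rintro (i | i)
    · obtain ⟨t, ht⟩ := F.vertex_covered i
      exact ⟨.inl t, by simpa using ht⟩
    · obtain ⟨t, ht⟩ := G.vertex_covered i
      exact ⟨.inr t, by simpa using ht⟩
  atom_covered α hα := by
    rcases Multiset.mem_add.1 hα with h | h
    · obtain ⟨β, hβ, rfl⟩ := Multiset.mem_map.1 h
      obtain ⟨t, ht⟩ := F.atom_covered β hβ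
      exact ⟨.inl t, verts_map_subset _ ht⟩
    · obtain ⟨β, hβ, rfl⟩ := Multiset.mem_map.1 h
      obtain ⟨t, ht⟩ := G.atom_covered β hβ
      exact ⟨.inr t, verts_map_subset _ ht⟩
  connected v := by
    refine SimpleGraph.Preconnected.induce_sum_sup_edge ?_ ?_ ?_
    · exact preconnected_image F.connected
        (Function.injective_id.sumMap Sum.inl_injective) v
    · exact preconnected_image G.connected
        (Function.injective_id.sumMap Sum.inr_injective) v
    · intro t₁ t₂ h₁ h₂
      -- only labels occur on both sides
      rcases v with s | i | i
      · have hs : s ∈ S := F.label_mem t₁ s (by simpa using h₁)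
        exact ⟨by simpa using F.root_bag s hs, by simpa using G.root_bag s (hST hs)⟩
      · simp at h₂
      · simp at h₁

lemma value_glue (F : LabelledGraph k S) (G : LabelledGraph k T) (hST : S ⊆ T)
    (σ : L → Fin n ⊕ Fin m) : (F.glue G hST).value σ = F.value σ * G.value σ := by
  rw [value, value, value, Finset.sum_mul_sum, ← Fintype.sum_prod_type']
  refine Fintype.sum_equiv (Equiv.sumArrowEquivProdArrow _ _ _) _ _ fun h => ?_
  simp only [glue, Multiset.map_add, Multiset.prod_add, Multiset.map_map, Function.comp_def,
    Atom.eval_map]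
  congr 4 <;> funext α <;> congr 1 <;> funext v <;> rcases v with v | v <;> rfl

/-- Turning the label `a` into an unlabelled vertex. -/
def unlabelMap (I : Type) (a : L) : L ⊕ I → L ⊕ Option I
  | .inl s => if s = a then .inr none else .inl s
  | .inr i => .inr (some i)

lemma unlabelMap_injective (I : Type) (a : L) : Function.Injective (unlabelMap I a) := by
  rintro (s | i) (t | j) h <;> simp only [unlabelMap] at h <;> grind

/-- Forgetting the label `a`. -/
def unlabel {a : L} (ha : a ∉ S) (F : LabelledGraph k (insert a S)) : LabelledGraph k S where
  I := Option F.I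
  atoms := F.atoms.map (Atom.map (unlabelMap F.I a))
  Node := F.Node
  tree := F.tree
  isTree := F.isTree
  root := F.root
  bag t := (F.bag t).image (unlabelMap F.I a)
  card_bag t := Finset.card_image_le.trans (F.card_bag t)
  root_bag s hs := Finset.mem_image.2 ⟨.inl s, F.root_bag s (Finset.mem_insert_of_mem hs), by
    simp [unlabelMap, ne_of_mem_of_not_mem hs ha]⟩
  label_mem t s hs := by
    obtain ⟨v, hv, hvs⟩ := Finset.mem_image.1 hs
    rcases v with s' | i
    · by_cases h : s' = a
      · simp [unlabelMap, h] at hvs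
      · simp only [unlabelMap, h, if_false, Sum.inl.injEq] at hvs
        subst hvs
        exact (Finset.mem_insert.1 (F.label_mem t s' hv)).resolve_left h
    · simp [unlabelMap] at hvs
  vertex_covered := by
    rintro (_ | i)
    · exact ⟨F.root, Finset.mem_image.2
        ⟨.inl a, F.root_bag a (Finset.mem_insert_self a S), by simp [unlabelMap]⟩⟩
    · obtain ⟨t, ht⟩ := F.vertex_covered i
      exact ⟨t, Finset.mem_image.2 ⟨_, ht, rfl⟩⟩
  atom_covered α hα := by
    obtain ⟨β, hβ, rfl⟩ := Multiset.mem_map.1 hα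
    obtain ⟨t, ht⟩ := F.atom_covered β hβ
    exact ⟨t, verts_map_subset _ ht⟩
  connected v := preconnected_image F.connected (unlabelMap_injective _ a) v

lemma value_unlabel {a : L} (ha : a ∉ S) (F : LabelledGraph k (insert a S))
    (σ : L → Fin n ⊕ Fin m) :
    (F.unlabel ha).value σ = ∑ u, F.value (Function.update σ a u) := by
  simp only [value]
  rw [← Fintype.sum_prod_type']
  refine Fintype.sum_equiv (Equiv.piOptionEquivProd (β := fun _ => Fin n ⊕ Fin m)) _ _ fun h => ?_
  simp only [unlabel, Multiset.map_map, Function.comp_def, Atom.eval_map]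
  congr 2
  funext α
  congr 1
  funext v
  rcases v with s | i
  · by_cases hs : s = a
    · subst hs; simp [unlabelMap]
    · simp [unlabelMap, hs]
  · rfl

end LabelledGraph

lemma Gen.exists_labelledGraph {L : Type} [DecidableEq L] {k n m : ℕ} {S : Finset L}
    {f : (L → Fin n ⊕ Fin m) → MvPolynomial (Fin n × Fin m) ℚ} (hf : Gen k S f) :
    ∃ F : LabelledGraph k S, ∀ σ, F.value σ = f σ := by
  induction hf with
  | one hS => exact ⟨.single hS 0 (by simp), fun σ => by simp [LabelledGraph.value_single]⟩
  | atom hS α hα =>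
    exact ⟨.single hS {α} (by simpa using hα), fun σ => by simp [LabelledGraph.value_single]⟩
  | mul hST _ _ ihf ihg =>
    obtain ⟨F, hF⟩ := ihf
    obtain ⟨G, hG⟩ := ihg
    exact ⟨F.glue G hST, fun σ => by simp [LabelledGraph.value_glue, hF, hG]⟩
  | sum ha _ ih =>
    obtain ⟨F, hF⟩ := ih
    exact ⟨F.unlabel ha, fun σ => by simp only [LabelledGraph.value_unlabel, hF]⟩

/-! ### Distributing the vertices to the two sides -/

namespace Atom

variable {I : Type}

/-- The atom is compatible with the side `τ` (`true` for `A`, `false` for `B`) of each vertex. -/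
def Respects (τ : I → Bool) : Atom I → Prop
  | edge a b => τ a = true ∧ τ b = false
  | inA a => τ a = true
  | inB a => τ a = false

/-- The edge given by an atom between the two sides, if any. -/
def toEdge (τ : I → Bool) : Atom I → Option ({i // τ i = true} × {i // τ i = false})
  | edge a b => if h : τ a = true ∧ τ b = false then some (⟨a, h.1⟩, ⟨b, h.2⟩) else none
  | inA _ => none
  | inB _ => none

lemma eq_edge_of_toEdge {τ : I → Bool} {α : Atom I} {e : {i // τ i = true} × {i // τ i = false}}
    (h : α.toEdge τ = some e) : α = edge e.1.1 e.2.1 := by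
  cases α with
  | edge a b =>
    simp only [toEdge, Option.dite_none_right_eq_some, Option.some.injEq] at h
    obtain ⟨-, rfl⟩ := h
    rfl
  | inA a => simp [toEdge] at h
  | inB a => simp [toEdge] at h

end Atom

section

variable {I : Type} [Fintype I] [DecidableEq I] {n m : ℕ}

/-- The bipartite multigraph obtained from a multiset of atoms by placing each vertex on the
side given by `τ`. -/
def sideGraph (M : Multiset (Atom I)) (τ : I → Bool) : BipMultigraph where
  A := {i // τ i = true}
  B := {i // τ i = false}
  E := M.filterMap (Atom.toEdge τ)

/-- The placement of all vertices combined from placements of the two sides. -/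
def combine (τ : I → Bool) (f : {i // τ i = true} → Fin n) (g : {i // τ i = false} → Fin m) (i : I) :
    Fin n ⊕ Fin m :=
  if h : τ i = true then .inl (f ⟨i, h⟩) else .inr (g ⟨i, by simpa using h⟩)

omit [Fintype I] [DecidableEq I] in
lemma prod_eval_combine (M : Multiset (Atom I)) (τ : I → Bool) (hM : ∀ α ∈ M, α.Respects τ)
    (f : {i // τ i = true} → Fin n) (g : {i // τ i = false} → Fin m) :
    (M.map fun α => α.eval (combine τ f g)).prod = ((M.filterMap (Atom.toEdge τ)).map fun e =>
      (MvPolynomial.X (f e.1, g e.2) : MvPolynomial (Fin n × Fin m) ℚ)).prod := by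
  induction M using Multiset.induction_on with
  | empty => simp
  | cons α M ih =>
    have hα := hM α (Multiset.mem_cons_self α M)
    rw [Multiset.map_cons, Multiset.prod_cons, ih fun β hβ => hM β (Multiset.mem_cons_of_mem hβ)]
    cases α with
    | edge a b =>
      rw [Multiset.filterMap_cons_some (b := (⟨a, hα.1⟩, ⟨b, hα.2⟩))]
      · have h1 : combine τ f g a = .inl (f ⟨a, hα.1⟩) := dif_pos hα.1
        have h2 : combine τ f g b = .inr (g ⟨b, hα.2⟩) := dif_neg (by simp [hα.2])
        simp [Atom.eval, h1, h2]
      · exact dif_pos hα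
    | inA a =>
      have h1 : combine τ f g a = .inl (f ⟨a, hα⟩) := dif_pos hα
      rw [Multiset.filterMap_cons_none _ _ rfl]
      simp [Atom.eval, h1]
    | inB a =>
      have h1 : combine τ f g a = .inr (g ⟨a, hα⟩) :=
        dif_neg (by rw [show τ a = false from hα]; simp)
      rw [Multiset.filterMap_cons_none _ _ rfl]
      simp [Atom.eval, h1]

omit [Fintype I] [DecidableEq I] in
lemma respects_of_eval_ne_zero {α : Atom I} {h : I → Fin n ⊕ Fin m}
    (hα : α.eval h ≠ 0) : α.Respects fun i => (h i).isLeft := by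
  cases α with
  | edge a b =>
    rcases ha : h a with i | i <;> rcases hb : h b with j | j <;>
      simp_all [Atom.eval, Atom.Respects]
  | inA a => rcases ha : h a with i | i <;> simp_all [Atom.eval, Atom.Respects]
  | inB a => rcases ha : h a with i | i <;> simp_all [Atom.eval, Atom.Respects]

open Classical in
/-- A sum over all placements splits according to the sides on which the vertices are placed. -/
lemma sum_prod_eval_eq_sum_homPoly (M : Multiset (Atom I)) :
    ∑ h : I → Fin n ⊕ Fin m, (M.map fun α => α.eval h).prod =
      ∑ τ : I → Bool, if ∀ α ∈ M, α.Respects τ then (sideGraph M τ).homPoly n m else 0 := by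
  rw [← Finset.sum_fiberwise Finset.univ fun (h : I → Fin n ⊕ Fin m) i => (h i).isLeft]
  refine Finset.sum_congr rfl fun τ _ => ?_
  split_ifs with hM
  · rw [BipMultigraph.homPoly, ← Fintype.sum_prod_type']
    symm
    refine Finset.sum_bij (fun p _ => combine τ p.1 p.2) ?_ ?_ ?_ ?_
    · rintro ⟨f, g⟩ -
      rw [Finset.mem_filter]
      refine ⟨Finset.mem_univ _, funext fun i => ?_⟩
      by_cases hi : τ i = true <;> simp [combine, hi]
    · rintro ⟨f, g⟩ - ⟨f', g'⟩ - h
      refine Prod.ext (funext fun a => ?_) (funext fun b => ?_)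
      · have h1 := congrFun h a.1
        simp only [combine, dif_pos a.2, Sum.inl.injEq] at h1
        exact h1
      · have h1 := congrFun h b.1
        have hb : ¬ τ b.1 = true := by simp [b.2]
        simp only [combine, dif_neg hb, Sum.inr.injEq] at h1
        exact h1
    · intro h hh
      obtain rfl := (Finset.mem_filter.1 hh).2
      refine ⟨(fun a => (h a.1).getLeft a.2, fun b => (h b.1).getRight (by simpa using b.2)),
        Finset.mem_univ _, funext fun i => ?_⟩
      rcases hi : h i with j | j <;> simp [combine, hi]
    · rintro ⟨f, g⟩ -
      exact (prod_eval_combine M τ hM f g).symm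
  · refine Finset.sum_eq_zero fun h hh => ?_
    obtain rfl := (Finset.mem_filter.1 hh).2
    push Not at hM
    obtain ⟨α, hα, hne⟩ := hM
    refine Multiset.prod_eq_zero (Multiset.mem_map.2 ⟨α, hα, ?_⟩)
    by_contra h0
    exact hne (respects_of_eval_ne_zero h0)

end

namespace LabelledGraph

variable {L : Type} [DecidableEq L] {k n m : ℕ}

/-- Without labels, all atoms are atoms on the unlabelled vertices. -/
lemma exists_atoms_eq_map (F : LabelledGraph k (∅ : Finset L)) :
    ∃ M : Multiset (Atom F.I), F.atoms = M.map (Atom.map Sum.inr) := by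
  have hlift : ∀ α ∈ F.atoms, ∃ β : Atom F.I, Atom.map Sum.inr β = α := by
    intro α hα
    obtain ⟨t, ht⟩ := F.atom_covered α hα
    have hv : ∀ v ∈ α.verts, ∃ i, v = Sum.inr i := by
      rintro (s | i) hv
      · exact absurd (F.label_mem t s (ht hv)) (Finset.notMem_empty s)
      · exact ⟨i, rfl⟩
    cases α with
    | edge a b =>
      obtain ⟨i, rfl⟩ := hv a (by simp [Atom.verts])
      obtain ⟨j, rfl⟩ := hv b (by simp [Atom.verts])
      exact ⟨.edge i j, rfl⟩
    | inA a =>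
      obtain ⟨i, rfl⟩ := hv a (by simp [Atom.verts])
      exact ⟨.inA i, rfl⟩
    | inB a =>
      obtain ⟨i, rfl⟩ := hv a (by simp [Atom.verts])
      exact ⟨.inB i, rfl⟩
  generalize F.atoms = N at hlift
  induction N using Multiset.induction_on with
  | empty => exact ⟨0, rfl⟩
  | cons α N ih =>
    obtain ⟨β, rfl⟩ := hlift α (by simp)
    obtain ⟨M, rfl⟩ := ih fun γ hγ => hlift γ (Multiset.mem_cons_of_mem hγ)
    exact ⟨β ::ₘ M, by simp⟩

lemma treewidth_sideGraph_lt (F : LabelledGraph k (∅ : Finset L)) {M : Multiset (Atom F.I)}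
    (hM : F.atoms = M.map (Atom.map Sum.inr)) (τ : F.I → Bool) :
    (sideGraph M τ).treewidth < k := by
  let vtx : (sideGraph M τ).V → F.I := Sum.elim Subtype.val Subtype.val
  have hvtx : Function.Injective vtx := by
    rintro (⟨a, ha⟩ | ⟨a, ha⟩) (⟨b, hb⟩ | ⟨b, hb⟩) (h : a = b)
    · simp [h]
    · subst h; simp [ha] at hb
    · subst h; simp [ha] at hb
    · simp [h]
  refine (BipMultigraph.treewidth_lt_iff _).2 ⟨
    { Node := F.Node
      tree := F.tree
      isTree := F.isTree
      bag := fun t => Finset.univ.filter fun v => Sum.inr (vtx v) ∈ F.bag t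
      vertex_covered := fun v => by
        obtain ⟨t, ht⟩ := F.vertex_covered (vtx v)
        exact ⟨t, by simpa using ht⟩
      edge_covered := fun e he => by
        obtain ⟨α, hα, hαe⟩ := (Multiset.mem_filterMap (Atom.toEdge τ) M).1 he
        obtain ⟨t, ht⟩ := F.atom_covered (α.map Sum.inr) (by
          rw [hM]; exact Multiset.mem_map_of_mem _ hα)
        rw [Atom.eq_edge_of_toEdge hαe] at ht
        simp only [Atom.map, Atom.verts, Set.insert_subset_iff, Set.singleton_subset_iff,
          Finset.mem_coe] at ht
        exact ⟨t, Finset.mem_filter.2 ⟨Finset.mem_univ _, ht.1⟩,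
          Finset.mem_filter.2 ⟨Finset.mem_univ _, ht.2⟩⟩
      connected := fun v => by
        obtain ⟨t, ht⟩ := F.vertex_covered (vtx v)
        have hset : {t | v ∈ Finset.univ.filter fun v => Sum.inr (vtx v) ∈ F.bag t} =
            {t | Sum.inr (vtx v) ∈ F.bag t} := by ext; simp
        rw [hset]
        exact { preconnected := F.connected _, nonempty := ⟨⟨t, ht⟩⟩ } }, fun t => ?_⟩
  refine le_trans (Finset.card_le_card_of_injOn (fun v => Sum.inr (vtx v)) (fun v hv => ?_)
    fun v _ w _ h => hvtx (Sum.inr_injective h)) (F.card_bag t)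
  simpa using hv

end LabelledGraph

/-- A polynomial generated without labels is a combination of homomorphism polynomials. -/
lemma Gen.exists_mem_treewidthSpan {L : Type} [DecidableEq L] {k n m : ℕ}
    {f : (L → Fin n ⊕ Fin m) → MvPolynomial (Fin n × Fin m) ℚ} (hf : Gen k ∅ f) :
    ∃ q ∈ treewidthSpan k n m, ∀ σ, f σ = q := by
  classical
  obtain ⟨F, hF⟩ := hf.exists_labelledGraph
  obtain ⟨M, hM⟩ := F.exists_atoms_eq_map
  refine ⟨∑ τ : F.I → Bool, if ∀ α ∈ M, α.Respects τ then (sideGraph M τ).homPoly n m else 0,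
    ?_, fun σ => ?_⟩
  · refine Submodule.sum_mem _ fun τ _ => ?_
    split_ifs
    · exact Submodule.subset_span ⟨_, F.treewidth_sideGraph_lt hM τ, rfl⟩
    · exact Submodule.zero_mem _
  · rw [← hF, LabelledGraph.value, hM, ← sum_prod_eval_eq_sum_homPoly]
    simp [Atom.eval_map, Function.comp_def]

/-! ### Counting formulas as combinations of labelled homomorphism polynomials -/

section

variable {k n m : ℕ} {S T : Finset ℕ}

/-- The algebra of functions of placements generated by labelled graphs with labels `S`. -/
noncomputable def genAlgebra (k n m : ℕ) (S : Finset ℕ) :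
    Subalgebra ℚ ((ℕ → Fin n ⊕ Fin m) → MvPolynomial (Fin n × Fin m) ℚ) :=
  Algebra.adjoin ℚ {f | Gen k S f}

lemma toSubmodule_genAlgebra (hS : S.card ≤ k) :
    Subalgebra.toSubmodule (genAlgebra k n m S) = Submodule.span ℚ {f | Gen k S f} := by
  refine Algebra.adjoin_eq_span_of_subset ℚ fun f hf => Submodule.subset_span ?_
  induction hf using Submonoid.closure_induction with
  | mem f hf => exact hf
  | one => exact .one hS
  | mul f g _ _ hf hg => exact .mul subset_rfl hf hg

lemma mem_genAlgebra_iff (hS : S.card ≤ k)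
    {f : (ℕ → Fin n ⊕ Fin m) → MvPolynomial (Fin n × Fin m) ℚ} :
    f ∈ genAlgebra k n m S ↔ f ∈ Submodule.span ℚ {f | Gen k S f} := by
  rw [← toSubmodule_genAlgebra hS, Subalgebra.mem_toSubmodule]

lemma genAlgebra_mono (hST : S ⊆ T) (hT : T.card ≤ k) :
    genAlgebra k n m S ≤ genAlgebra k n m T :=
  Algebra.adjoin_mono fun _ hf => Gen.weaken hf hST hT

/-- A linear operation on functions which preserves labelled graphs preserves their
combinations. -/
lemma genAlgebra_map
    (Φ : ((ℕ → Fin n ⊕ Fin m) → MvPolynomial (Fin n × Fin m) ℚ) →ₗ[ℚ]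
      ((ℕ → Fin n ⊕ Fin m) → MvPolynomial (Fin n × Fin m) ℚ))
    (hS : S.card ≤ k) (hΦ : ∀ f, Gen k S f → Gen k T (Φ f))
    {f : (ℕ → Fin n ⊕ Fin m) → MvPolynomial (Fin n × Fin m) ℚ} (hf : f ∈ genAlgebra k n m S) :
    Φ f ∈ genAlgebra k n m T := by
  rw [mem_genAlgebra_iff hS] at hf
  have : Submodule.span ℚ {f | Gen k S f} ≤
      (Subalgebra.toSubmodule (genAlgebra k n m T)).comap Φ :=
    Submodule.span_le.2 fun g hg => Algebra.subset_adjoin (hΦ g hg)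
  exact this hf

/-- Precomposition with a map of placements. -/
noncomputable def pullback (ψ : (ℕ → Fin n ⊕ Fin m) → (ℕ → Fin n ⊕ Fin m)) :
    ((ℕ → Fin n ⊕ Fin m) → MvPolynomial (Fin n × Fin m) ℚ) →ₗ[ℚ]
      ((ℕ → Fin n ⊕ Fin m) → MvPolynomial (Fin n × Fin m) ℚ) :=
  LinearMap.funLeft ℚ _ ψ

/-- The sum over all positions of `a` different from those of the labels in `S`. Coincidences
are subtracted by identifying `a` with a label. -/
lemma exists_sum_outside {a : ℕ} (ha : a ∉ S) (hk : (insert a S).card ≤ k)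
    {f : (ℕ → Fin n ⊕ Fin m) → MvPolynomial (Fin n × Fin m) ℚ}
    (hf : f ∈ genAlgebra k n m (insert a S)) :
    ∃ f' ∈ genAlgebra k n m S, ∀ σ : ℕ → Fin n ⊕ Fin m, Set.InjOn σ S →
      f' σ = ∑ u ∈ (S.image σ)ᶜ, f (Function.update σ a u) := by
  have h1 : (∑ u, pullback fun σ => Function.update σ a u) f ∈ genAlgebra k n m S := by
    refine genAlgebra_map _ hk (fun g hg => ?_) hf
    convert Gen.sum ha hg using 1
    funext σ
    simp [pullback, LinearMap.funLeft]
  have h2 : ∀ s ∈ S, pullback (fun σ => Function.update σ a (σ s)) f ∈ genAlgebra k n m S := by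
    intro s hs
    refine genAlgebra_map _ hk (fun g hg => ?_) hf
    have := hg.pull (Function.update id a s)
    have himg : (insert a S).image (Function.update id a s) = S := by
      rw [Finset.image_insert, Function.update_self]
      have : S.image (Function.update id a s) = S := by
        conv_rhs => rw [← Finset.image_id (s := S)]
        refine Finset.image_congr fun t ht => ?_
        exact Function.update_of_ne (ne_of_mem_of_not_mem ht ha) _ _
      rw [this, Finset.insert_eq_of_mem hs]
    rw [himg] at this
    convert this using 1
    funext σ
    simp only [pullback, LinearMap.funLeft_apply]
    congr 1
    funext t
    by_cases ht : t = a
    · subst ht; simp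
    · simp [ht]
  refine ⟨(∑ u, pullback fun σ => Function.update σ a u) f -
    ∑ s ∈ S, pullback (fun σ => Function.update σ a (σ s)) f,
    sub_mem h1 (sum_mem fun s hs => h2 s hs), fun σ hσ => ?_⟩
  rw [← Finset.sum_compl_add_sum (S.image σ)]
  rw [LinearMap.add_apply, LinearMap.sum_apply, LinearMap.sum_apply,
    Finset.sum_image (by simpa [Set.InjOn] using hσ)]
  simp [pullback, LinearMap.funLeft_apply, Finset.sum_apply]

/-- The set of values of a partial labelling of the variables. -/
def labels (ℓ : Fin k → Option ℕ) : Finset ℕ :=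
  Finset.univ.biUnion fun x => (ℓ x).toFinset

lemma mem_labels {ℓ : Fin k → Option ℕ} {s : ℕ} : s ∈ labels ℓ ↔ ∃ x, ℓ x = some s := by
  simp [labels]

lemma card_labels_le (ℓ : Fin k → Option ℕ) : (labels ℓ).card ≤ k := by
  refine Finset.card_biUnion_le.trans ((Finset.sum_le_card_nsmul _ _ 1 fun x _ => ?_).trans ?_)
  · cases ℓ x <;> simp
  · simp

/-- Evaluation as an algebra homomorphism. -/
noncomputable def evalHom (G : WeightedBip n m) (σ : ℕ → Fin n ⊕ Fin m) :
    ((ℕ → Fin n ⊕ Fin m) → MvPolynomial (Fin n × Fin m) ℚ) →ₐ[ℚ] ℚ :=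
  (MvPolynomial.aeval fun ij : Fin n × Fin m => G ij.1 ij.2).comp (Pi.evalAlgHom ℚ _ σ)

lemma evalHom_apply (G : WeightedBip n m) (σ : ℕ → Fin n ⊕ Fin m)
    (f : (ℕ → Fin n ⊕ Fin m) → MvPolynomial (Fin n × Fin m) ℚ) :
    evalHom G σ f = evalAt (f σ) G := by
  simp [evalHom, evalAt, MvPolynomial.aeval_eq_eval]

/-- Composition with a univariate polynomial turns a counting function into the indicator of
a threshold. -/
lemma exists_threshold (i N : ℕ) {c : (ℕ → Fin n ⊕ Fin m) → MvPolynomial (Fin n × Fin m) ℚ}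
    (hc : c ∈ genAlgebra k n m S) :
    ∃ f ∈ genAlgebra k n m S, ∀ (G : WeightedBip n m) σ (j : ℕ), j ≤ N →
      evalHom G σ c = j → evalHom G σ f = if i ≤ j then 1 else 0 := by
  let P : Polynomial ℚ := Lagrange.interpolate (Finset.range (N + 1)) (fun j : ℕ => (j : ℚ))
    fun j => if i ≤ j then 1 else 0
  refine ⟨Polynomial.aeval c P, ?_, fun G σ j hj h => ?_⟩
  · exact Algebra.adjoin_le (Set.singleton_subset_iff.2 hc)
      (Polynomial.aeval_mem_adjoin_singleton ℚ c)
  · rw [← Polynomial.aeval_algHom_apply, h, Polynomial.aeval_def, Algebra.algebraMap_self,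
      Polynomial.eval₂_id]
    exact Lagrange.eval_interpolate_at_node _ (Nat.cast_injective.injOn) (by simp; omega)

open Classical in
/-- The truth value of a formula is a combination of labelled homomorphism polynomials, as long as
different labels are placed at different positions. This restriction is what allows equality to
be expressed. -/
lemma CFormula.exists_represent (φ : CFormula k) (ℓ : Fin k → Option ℕ) :
    ∃ f ∈ genAlgebra k n m (labels ℓ), ∀ G : WeightedBip n m, G.IsSimple →
      ∀ σ : ℕ → Fin n ⊕ Fin m, Set.InjOn σ (labels ℓ) →
        evalHom G σ f = if φ.Realize G (fun x => (ℓ x).map σ) then 1 else 0 := by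
  induction φ generalizing ℓ with
  | falsum => exact ⟨0, zero_mem _, fun G _ σ _ => by simp [Realize]⟩
  | eq x y =>
    by_cases h : ∃ s, ℓ x = some s ∧ ℓ y = some s
    · obtain ⟨s, hx, hy⟩ := h
      exact ⟨1, one_mem _, fun G _ σ _ => by simp [Realize, hx, hy]⟩
    · refine ⟨0, zero_mem _, fun G _ σ hσ => ?_⟩
      rw [map_zero, if_neg]
      rintro ⟨u, hxu, hyu⟩
      obtain ⟨s, hs, rfl⟩ := Option.map_eq_some_iff.1 hxu
      obtain ⟨t, ht, hts⟩ := Option.map_eq_some_iff.1 hyu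
      have := hσ (mem_labels.2 ⟨y, ht⟩) (mem_labels.2 ⟨x, hs⟩) hts
      exact h ⟨s, hs, this ▸ ht⟩
  | inA x =>
    rcases hx : ℓ x with _ | s
    · exact ⟨0, zero_mem _, fun G _ σ _ => by simp [Realize, hx]⟩
    · refine ⟨fun σ => (Atom.inA s).eval σ, Algebra.subset_adjoin (.atom (card_labels_le ℓ) _ ?_),
        fun G _ σ _ => ?_⟩
      · simpa [Atom.verts] using mem_labels.2 ⟨x, hx⟩
      · rcases h : σ s with u | u <;> simp [Realize, hx, evalHom_apply, Atom.eval, h, evalAt]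
  | inB x =>
    rcases hx : ℓ x with _ | s
    · exact ⟨0, zero_mem _, fun G _ σ _ => by simp [Realize, hx]⟩
    · refine ⟨fun σ => (Atom.inB s).eval σ, Algebra.subset_adjoin (.atom (card_labels_le ℓ) _ ?_),
        fun G _ σ _ => ?_⟩
      · simpa [Atom.verts] using mem_labels.2 ⟨x, hx⟩
      · rcases h : σ s with u | u <;> simp [Realize, hx, evalHom_apply, Atom.eval, h, evalAt]
  | rel q x y =>
    rcases hx : ℓ x with _ | s
    · exact ⟨0, zero_mem _, fun G _ σ _ => by simp [Realize, hx]⟩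
    rcases hy : ℓ y with _ | t
    · exact ⟨0, zero_mem _, fun G _ σ _ => by simp [Realize, hy]⟩
    have hs : s ∈ labels ℓ := mem_labels.2 ⟨x, hx⟩
    have ht : t ∈ labels ℓ := mem_labels.2 ⟨y, hy⟩
    have hA : (fun σ => (Atom.inA s).eval σ) ∈ genAlgebra k n m (labels ℓ) :=
      Algebra.subset_adjoin (.atom (card_labels_le ℓ) _ (by simpa [Atom.verts] using hs))
    have hB : (fun σ => (Atom.inB t).eval σ) ∈ genAlgebra k n m (labels ℓ) :=
      Algebra.subset_adjoin (.atom (card_labels_le ℓ) _ (by simpa [Atom.verts] using ht))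
    have hE : (fun σ => (Atom.edge s t).eval σ) ∈ genAlgebra k n m (labels ℓ) :=
      Algebra.subset_adjoin (.atom (card_labels_le ℓ) _ (by
        simp [Atom.verts, Set.insert_subset_iff, hs, ht]))
    -- on simple graphs only the relations for `0` and `1` are non-empty
    by_cases h1 : q = 1
    · refine ⟨_, hE, fun G hG σ _ => ?_⟩
      rcases hσs : σ s with i | i <;> rcases hσt : σ t with j | j <;>
        simp [Realize, hx, hy, evalHom_apply, Atom.eval, hσs, hσt, evalAt, h1]
      rcases hG i j with h | h <;> simp [h]
    by_cases h0 : q = 0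
    · refine ⟨_, sub_mem (mul_mem hA hB) hE, fun G hG σ _ => ?_⟩
      rcases hσs : σ s with i | i <;> rcases hσt : σ t with j | j <;>
        simp [Realize, hx, hy, evalHom_apply, Atom.eval, hσs, hσt, evalAt, h0]
      rcases hG i j with h | h <;> simp [h]
    · refine ⟨0, zero_mem _, fun G hG σ _ => ?_⟩
      rw [map_zero, if_neg]
      rintro ⟨i, j, -, -, h⟩
      rcases hG i j with h' | h'
      · exact h0 (h.symm.trans h')
      · exact h1 (h.symm.trans h')
  | neg φ ih =>
    obtain ⟨f, hf, h⟩ := ih ℓ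
    refine ⟨1 - f, sub_mem (one_mem _) hf, fun G hG σ hσ => ?_⟩
    rw [map_sub, map_one, h G hG σ hσ]
    by_cases hr : φ.Realize G (fun x => (ℓ x).map σ) <;> simp [Realize, hr]
  | and φ ψ ihφ ihψ =>
    obtain ⟨f, hf, h⟩ := ihφ ℓ
    obtain ⟨g, hg, h'⟩ := ihψ ℓ
    refine ⟨f * g, mul_mem hf hg, fun G hG σ hσ => ?_⟩
    rw [map_mul, h G hG σ hσ, h' G hG σ hσ]
    by_cases hr : φ.Realize G (fun x => (ℓ x).map σ) <;> simp [Realize, hr]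
  | existsGe i x φ ih =>
    set S := labels (Function.update ℓ x none) with hS
    have mem_S : ∀ s, s ∈ S ↔ ∃ y, y ≠ x ∧ ℓ y = some s := by
      intro s
      rw [hS, mem_labels]
      refine exists_congr fun y => ?_
      by_cases hy : y = x <;> simp [hy]
    have hSℓ : S ⊆ labels ℓ := fun s hs => by
      obtain ⟨y, -, hy⟩ := (mem_S s).1 hs
      exact mem_labels.2 ⟨y, hy⟩
    have labels_some : ∀ s, labels (Function.update ℓ x (some s)) = insert s S := by
      intro s
      ext t
      rw [mem_labels, Finset.mem_insert, mem_S]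
      constructor
      · rintro ⟨y, hy⟩
        by_cases hyx : y = x
        · subst hyx; simp at hy; exact .inl hy.symm
        · exact .inr ⟨y, hyx, by simpa [hyx] using hy⟩
      · rintro (rfl | ⟨y, hyx, hy⟩)
        · exact ⟨x, by simp⟩
        · exact ⟨y, by simpa [hyx] using hy⟩
    obtain ⟨a, ha⟩ := Infinite.exists_notMem_finset S
    choose F hF hFeval using fun s => ih (Function.update ℓ x (some s))
    simp only [labels_some] at hF hFeval
    have hk : (insert a S).card ≤ k := labels_some a ▸ card_labels_le _
    obtain ⟨f', hf', hf'eval⟩ := exists_sum_outside ha hk (hF a)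
    -- the number of witnesses: those at the position of a label, and the others
    have hc : ∑ s ∈ S, F s + f' ∈ genAlgebra k n m (labels ℓ) := by
      refine genAlgebra_mono hSℓ (card_labels_le ℓ) (add_mem (sum_mem fun s hs => ?_) hf')
      have := hF s
      rwa [Finset.insert_eq_of_mem hs] at this
    obtain ⟨f, hf, hfeval⟩ := exists_threshold i (Fintype.card (Fin n ⊕ Fin m)) hc
    refine ⟨f, hf, fun G hG σ hσ => ?_⟩
    have hσS : Set.InjOn σ S := hσ.mono (by exact_mod_cast hSℓ)
    let W : Fin n ⊕ Fin m → Prop := fun u =>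
      φ.Realize G (Function.update (fun y => (ℓ y).map σ) x (some u))
    have hin : ∀ s ∈ S, evalHom G σ (F s) = if W (σ s) then 1 else 0 := by
      intro s hs
      rw [hFeval s G hG σ (by rwa [Finset.insert_eq_of_mem hs])]
      have : (fun y => (Function.update ℓ x (some s) y).map σ) =
          Function.update (fun y => (ℓ y).map σ) x (some (σ s)) := by
        funext y
        by_cases hy : y = x
        · subst hy; simp
        · simp [hy]
      rw [this]
    have hout : ∀ u ∈ (S.image σ)ᶜ,
        evalHom G (Function.update σ a u) (F a) = if W u then 1 else 0 := by
      intro u hu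
      have hu' : ∀ s ∈ S, σ s ≠ u := fun s hs h =>
        Finset.mem_compl.1 hu (Finset.mem_image.2 ⟨s, hs, h⟩)
      have hne : ∀ s ∈ S, s ≠ a := fun s hs => ne_of_mem_of_not_mem hs ha
      rw [hFeval a G hG]
      · have : (fun y => (Function.update ℓ x (some a) y).map (Function.update σ a u)) =
            Function.update (fun y => (ℓ y).map σ) x (some u) := by
          funext y
          by_cases hy : y = x
          · subst hy; simp
          · rcases hs : ℓ y with _ | s
            · simp [hy, hs]
            · have := hne s ((mem_S s).2 ⟨y, hy, hs⟩)
              simp [hy, hs, this]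
        rw [this]
      · rw [Finset.coe_insert, Set.injOn_insert (by simpa using ha)]
        constructor
        · refine hσS.congr fun s hs => ?_
          rw [Function.update_of_ne (hne s hs)]
        · rintro ⟨s, hs, h⟩
          rw [Function.update_self, Function.update_of_ne (hne s hs)] at h
          exact hu' s hs h
    have hcount : evalHom G σ (∑ s ∈ S, F s + f') = ((Finset.univ.filter W).card : ℚ) := by
      have h2 : evalHom G σ f' = ∑ u ∈ (S.image σ)ᶜ, if W u then 1 else 0 := by
        rw [evalHom_apply, hf'eval σ hσS, evalAt, map_sum]
        refine Finset.sum_congr rfl fun u hu => ?_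
        rw [← hout u hu, evalHom_apply, evalAt]
      rw [map_add, map_sum, Finset.sum_congr rfl hin, h2,
        ← Finset.sum_image (f := fun u => if W u then (1 : ℚ) else 0) hσS,
        Finset.sum_add_sum_compl, Finset.sum_boole]
    rw [hfeval G σ _ (Finset.card_le_univ _) hcount]
    have : (existsGe i x φ).Realize G (fun y => (ℓ y).map σ) ↔ i ≤ (Finset.univ.filter W).card := by
      rw [Realize, ← Set.ncard_coe_finset]
      simp [W]
    simp only [this]

open Classical in
/-- Every sentence with counting quantifiers is decided on simple graphs by a combination of
homomorphism polynomials. -/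
lemma CFormula.exists_mem_treewidthSpan [Nonempty (Fin n ⊕ Fin m)] (φ : CFormula k) :
    ∃ q ∈ treewidthSpan k n m, ∀ G : WeightedBip n m, G.IsSimple →
      evalAt q G = if φ.Models G then 1 else 0 := by
  obtain ⟨f, hf, h⟩ := φ.exists_represent (n := n) (m := m) fun _ => none
  have hlab : labels (fun _ : Fin k => none) = ∅ := by ext s; simp [mem_labels]
  rw [hlab] at hf h
  have key : ∃ q ∈ treewidthSpan k n m, ∀ σ, f σ = q := by
    rw [mem_genAlgebra_iff (by simp)] at hf
    clear h
    induction hf using Submodule.span_induction with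
    | mem f hf => exact Gen.exists_mem_treewidthSpan hf
    | zero => exact ⟨0, zero_mem _, fun _ => rfl⟩
    | add f g _ _ hf hg =>
      obtain ⟨q, hq, hfq⟩ := hf
      obtain ⟨r, hr, hgr⟩ := hg
      exact ⟨q + r, add_mem hq hr, fun σ => by simp [hfq, hgr]⟩
    | smul c f _ hf =>
      obtain ⟨q, hq, hfq⟩ := hf
      exact ⟨c • q, Submodule.smul_mem _ c hq, fun σ => by simp [hfq]⟩
  obtain ⟨q, hq, hfq⟩ := key
  refine ⟨q, hq, fun G hG => ?_⟩
  let σ : ℕ → Fin n ⊕ Fin m := fun _ => Classical.arbitrary _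
  rw [← hfq σ, ← evalHom_apply, h G hG σ (by simp)]
  rfl

end

/-! ### Multilinearisation -/

section

variable {n m : ℕ}

lemma evalAt_multilinearisation (p : MvPolynomial (Fin n × Fin m) ℚ) {G : WeightedBip n m}
    (hG : G.IsSimple) : evalAt (multilinearisation p) G = evalAt p G := by
  conv_rhs => rw [p.as_sum]
  simp only [evalAt, multilinearisation, map_sum, MvPolynomial.eval_monomial]
  refine Finset.sum_congr rfl fun s _ => ?_
  rw [Finsupp.prod_mapRange_index fun i => by simp]
  congr 1
  refine Finset.prod_congr rfl fun ij _ => ?_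
  rcases s ij with _ | e
  · rfl
  · rcases hG ij.1 ij.2 with h | h <;> simp [h]

lemma multilinearisation_mem_restrictDegree {σ : Type} (p : MvPolynomial σ ℚ) :
    multilinearisation p ∈ MvPolynomial.restrictDegree σ ℚ 1 := by
  refine Submodule.sum_mem _ fun s _ => ?_
  rw [MvPolynomial.mem_restrictDegree]
  intro t ht i
  rw [Finset.mem_singleton.1 (MvPolynomial.support_monomial_subset ht)]
  simp

/-- A multilinear polynomial is determined by its values on the cube. -/
lemma multilinearisation_eq_iff (p q : MvPolynomial (Fin n × Fin m) ℚ) :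
    multilinearisation p = multilinearisation q ↔
      ∀ G : WeightedBip n m, G.IsSimple → evalAt p G = evalAt q G := by
  constructor
  · intro h G hG
    rw [← evalAt_multilinearisation p hG, h, evalAt_multilinearisation q hG]
  · intro h
    rw [← sub_eq_zero]
    refine MvPolynomial.eq_zero_of_eval_zero_at_prod_finset _ (fun _ => {0, 1}) (fun i => ?_)
      fun x hx => ?_
    · have hmem := sub_mem (multilinearisation_mem_restrictDegree p)
        (multilinearisation_mem_restrictDegree q)
      rw [MvPolynomial.mem_restrictDegree] at hmem
      rw [MvPolynomial.degreeOf_lt_iff (by simp)]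
      intro s hs
      have := hmem s hs i
      simp
      omega
    · have hG : WeightedBip.IsSimple (fun i j => x (i, j) : WeightedBip n m) := fun i j => by
        simpa using hx (i, j)
      have := h _ hG
      rw [← evalAt_multilinearisation p hG, ← evalAt_multilinearisation q hG] at this
      rw [map_sub, sub_eq_zero]
      exact this

end

/-! ### Counting width -/

section

variable {k n m : ℕ}

lemma treewidthSpan_mono {k' : ℕ} (h : k ≤ k') : treewidthSpan k n m ≤ treewidthSpan k' n m :=
  Submodule.span_mono fun _ ⟨F, hF, hq⟩ => ⟨F, hF.trans_le (by exact_mod_cast h), hq⟩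

lemma one_mem_treewidthSpan : (1 : MvPolynomial (Fin n × Fin m) ℚ) ∈ treewidthSpan k n m := by
  obtain ⟨q, hq, h⟩ := (Gen.one (L := Empty) (n := n) (m := m) (k := k) (S := ∅)
    (by simp)).exists_mem_treewidthSpan
  rwa [show (1 : MvPolynomial (Fin n × Fin m) ℚ) = q from h Empty.elim]

/-- Combinations of homomorphism polynomials of graphs of treewidth less than `k` are invariant
under `C^k`-equivalence. -/
lemma evalAt_eq_of_cEquiv {q : MvPolynomial (Fin n × Fin m) ℚ} (hq : q ∈ treewidthSpan k n m)
    {G H : WeightedBip n m} (h : CEquiv k G H) : evalAt q G = evalAt q H := by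
  rcases isEmpty_or_nonempty (Fin n ⊕ Fin m) with he | hne
  · have : G = H := by
      ext i
      exact he.elim (.inl i)
    rw [this]
  · induction hq using Submodule.span_induction with
    | mem q hq =>
      obtain ⟨F, hF, rfl⟩ := hq
      obtain ⟨c, q, hq, hFq⟩ := F.exists_gen_of_treewidth_lt (n := n) (m := m) hF
      have := hq.evalAt_eq_of_cEquiv h
      simp only [evalAt] at this ⊢
      rw [hFq, MvPolynomial.smul_eval, MvPolynomial.smul_eval, this]
    | zero => simp [evalAt]
    | add f g _ _ hf hg =>
      simp only [evalAt, map_add] at hf hg ⊢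
      rw [hf, hg]
    | smul c f _ hf =>
      simp only [evalAt] at hf ⊢
      rw [MvPolynomial.smul_eval, MvPolynomial.smul_eval, hf]

lemma CEquiv.symm {G H : WeightedBip n m} (h : CEquiv k G H) : CEquiv k H G :=
  fun φ hφ => (h φ hφ).symm

lemma CEquiv.trans {G₁ G₂ G₃ : WeightedBip n m} (h : CEquiv k G₁ G₂) (h' : CEquiv k G₂ G₃) :
    CEquiv k G₁ G₃ :=
  fun φ hφ => (h φ hφ).trans (h' φ hφ)

instance finite_isSimple : Finite {G : WeightedBip n m // G.IsSimple} := by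
  refine Finite.of_injective (β := Fin n → Fin m → Bool) (fun G i j => decide (G.1 i j = 1)) ?_
  rintro ⟨G, hG⟩ ⟨H, hH⟩ h
  refine Subtype.ext (funext fun i => funext fun j => ?_)
  have hij : G i j = 1 ↔ H i j = 1 := by simpa using congrFun (congrFun h i) j
  rcases hG i j with h1 | h1 <;> rcases hH i j with h2 | h2 <;> simp_all

/-- A function on simple graphs that is invariant under `C^k`-equivalence is a combination of
indicators of the equivalence classes, each of which is defined by one sentence. -/
lemma exists_mem_treewidthSpan_of_invariant (f : WeightedBip n m → ℚ)
    (hf : ∀ G H : WeightedBip n m, G.IsSimple → H.IsSimple → CEquiv k G H → f G = f H) :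
    ∃ q ∈ treewidthSpan k n m, ∀ G : WeightedBip n m, G.IsSimple → evalAt q G = f G := by
  classical
  rcases isEmpty_or_nonempty (Fin n ⊕ Fin m) with he | hne
  · refine ⟨f 0 • 1, Submodule.smul_mem _ _ one_mem_treewidthSpan, fun G _ => ?_⟩
    have : G = 0 := by
      ext i
      exact he.elim (.inl i)
    simp [this, evalAt]
  have := Fintype.ofFinite {G : WeightedBip n m // G.IsSimple}
  have hχ : ∀ G : {G : WeightedBip n m // G.IsSimple}, ∃ q ∈ treewidthSpan k n m,
      ∀ H : {H : WeightedBip n m // H.IsSimple},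
        evalAt q H.1 = if CEquiv k G.1 H.1 then 1 else 0 := by
    intro G
    obtain ⟨χ, -, hχ⟩ := CFormula.exists_isolating (k := k) ∅
      (fun G : {G : WeightedBip n m // G.IsSimple} => G.1) (fun _ _ => none) G
    obtain ⟨q, hq, hqχ⟩ := χ.exists_mem_treewidthSpan (n := n) (m := m)
    refine ⟨q, hq, fun H => ?_⟩
    have : χ.Models H.1 ↔ CEquiv k G.1 H.1 := by
      rw [CFormula.Models, hχ H]
      simp [CFormula.Indist, CEquiv, CFormula.IsSentence, CFormula.Models]
    rw [hqχ H.1 H.2]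
    simp only [this]
  choose q hq hqG using hχ
  -- each class is counted once for each of its members, hence the division by its size
  let cls (G : {G : WeightedBip n m // G.IsSimple}) : Finset {G : WeightedBip n m // G.IsSimple} :=
    Finset.univ.filter fun H => CEquiv k H.1 G.1
  refine ⟨∑ G, (f G.1 / (cls G).card) • q G,
    Submodule.sum_mem _ fun G _ => Submodule.smul_mem _ _ (hq G), fun H hH => ?_⟩
  let H' : {G : WeightedBip n m // G.IsSimple} := ⟨H, hH⟩
  have hcls : ∀ G ∈ cls H', f G.1 / (cls G).card = f H / (cls H').card := by
    intro G hG
    have hGH : CEquiv k G.1 H := (Finset.mem_filter.1 hG).2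
    rw [hf G.1 H G.2 hH hGH]
    congr 3
    refine Finset.filter_congr fun K _ => ⟨fun h => h.trans hGH, fun h => h.trans hGH.symm⟩
  have hpos : ((cls H').card : ℚ) ≠ 0 := by
    rw [Nat.cast_ne_zero, Finset.card_ne_zero]
    exact ⟨H', Finset.mem_filter.2 ⟨Finset.mem_univ _, fun _ _ => Iff.rfl⟩⟩
  calc evalAt (∑ G, (f G.1 / (cls G).card) • q G) H
      = ∑ G, (f G.1 / (cls G).card) * evalAt (q G) H := by
        simp only [evalAt, map_sum, MvPolynomial.smul_eval]
    _ = ∑ G, if CEquiv k G.1 H then f G.1 / (cls G).card else 0 := by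
        refine Finset.sum_congr rfl fun G _ => ?_
        rw [hqG G H', mul_ite, mul_one, mul_zero]
    _ = ∑ G ∈ cls H', f H / (cls H').card := by
        rw [← Finset.sum_filter]
        exact Finset.sum_congr rfl hcls
    _ = f H := by
        rw [Finset.sum_const, nsmul_eq_mul, mul_div_cancel₀ _ hpos]

end

theorem mainTheorem6 (k n m : ℕ) (p : MvPolynomial (Fin n × Fin m) ℚ) :
    (∃ q ∈ treewidthSpan k n m, multilinearisation p = multilinearisation q) ↔
      simpleCountingWidth (evalAt p) ≤ (k : ℕ∞) := by
  constructor
  · rintro ⟨q, hq, hpq⟩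
    rw [multilinearisation_eq_iff] at hpq
    refine sInf_le ⟨k, fun G H hG hH h => ?_, rfl⟩
    rw [hpq G hG, hpq H hH, evalAt_eq_of_cEquiv hq h]
  · intro h
    -- the infimum defining the counting width is attained, as it is finite
    have hne : ((fun k : ℕ => (k : ℕ∞)) '' {k : ℕ | ∀ G H : WeightedBip n m,
        G.IsSimple → H.IsSimple → CEquiv k G H → evalAt p G = evalAt p H}).Nonempty := by
      by_contra hemp
      rw [Set.not_nonempty_iff_eq_empty] at hemp
      rw [simpleCountingWidth, hemp, sInf_empty] at h
      exact absurd h (by simp)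
    obtain ⟨k', hk', hk'w⟩ := csInf_mem hne
    have hle : k' ≤ k := by
      have : (k' : ℕ∞) ≤ k := hk'w.trans_le h
      exact_mod_cast this
    obtain ⟨q, hq, hqp⟩ := exists_mem_treewidthSpan_of_invariant _ hk'
    exact ⟨q, treewidthSpan_mono hle hq,
      (multilinearisation_eq_iff p q).2 fun G hG => (hqp G hG).symm⟩
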